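/- For a real number $\xi$ and $n\ge 1$, let $\widehat\lambda_n(\xi)$ be the supremum of all real $\lambda$ such that for all sufficiently large $Q$ there is $(x_0,\dots,x_n)\in\mathbb Z^{n+1}$ with $1\le |x_0|\le Q$ and $\max_{1\le i\le n}|x_0\xi^i-x_i|<Q^{-\lambda}$. Let $\omega_n(\xi)\in[n,\infty]$ (for $\xi$ transcendental) be the supremum of all real $\omega$ such that for an unbounded set of values $Q$ there is $P\in\mathbb Z[x]$ with $0<|P(\xi)|\le Q^{-\omega}$, $\deg P\le n$ and $H(P)\le Q$, where $H(P)$ is the maximum of the absolute values of the coefficients of $P$. Let $\xi\in\mathbb R$ be transcendental and let $k\ge 1$ be an integer such that $$\delta_k:=\frac{k}{\omega_k(\xi)+1-k}\ge 1 .$$ Then for every integer $n$, $$\widehat\lambda_n(\xi)\le\frac1{n-k}\qquad\text{if } 2k+1\le n<2k+1+\delta_k,$$ $$\widehat\lambda_n(\xi)\le\min\left\{\frac{1}{n-\left\lceil\frac{n-\delta_k-1}{2}\right\rceil},\ \frac{1}{\left\lfloor\frac{n-\delta_k-1}{2}\right\rfloor+1+\delta_k}\right\}\qquad\text{if } n\ge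 2k+1+\delta_k .$$ Moreover, if $\omega_k(\xi)=k$ and $n=3k+O(1)$, this gives $\widehat\lambda_n(\xi)\le\frac{3}{2n}+O(n^{-2})$: for every integer $c\ge 0$ there is a constant $C$ depending only on $c$ such that for all transcendental $\xi\in\mathbb R$ and all integers $k\ge1$, $n\ge 2k+1$ with $|n-3k|\le c$ and $\omega_k(\xi)=k$ one has $\widehat\lambda_n(\xi)\le \frac{3}{2n}+\frac{C}{n^2}$. -/

import Mathlib

open Filter

/-- The system `max_{1 ≤ i ≤ n} |x₀ ξ^i - x_i| < Q^(-lam)`, `1 ≤ |x₀| ≤ Q` has a solution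
`x ∈ ℤ^(n+1)`. -/
def SimultaneousSolvable (n : ℕ) (ξ lam Q : ℝ) : Prop :=
  ∃ x : Fin (n + 1) → ℤ,
    1 ≤ |x 0| ∧ ((|x 0| : ℤ) : ℝ) ≤ Q ∧
      ∀ i : Fin n, |(x 0 : ℝ) * ξ ^ ((i : ℕ) + 1) - (x i.succ : ℝ)| < Q ^ (-lam)

/-- The system `0 < |P(ξ)| ≤ Q^(-w)`, `deg P ≤ n`, `H(P) ≤ Q` has a solution `P ∈ ℤ[x]`,
where `H(P)` is the supremum norm of the coefficient vector. -/
def DualSolvable (n : ℕ) (ξ w Q : ℝ) : Prop :=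
  ∃ P : Polynomial ℤ,
    0 < |Polynomial.aeval ξ P| ∧ |Polynomial.aeval ξ P| ≤ Q ^ (-w) ∧
      P.natDegree ≤ n ∧ P.supNorm ≤ Q

/-- The uniform simultaneous Diophantine exponent: the supremum (in the extended reals) of all real
`lam` for which the simultaneous system is solvable for all large enough `Q`. -/
noncomputable def uniformSimultaneousExponent (n : ℕ) (ξ : ℝ) : EReal :=
  ⨆ (lam : ℝ) (_ : ∀ᶠ Q : ℝ in atTop, SimultaneousSolvable n ξ lam Q), (lam : EReal)

/-- The (ordinary) dual Diophantine exponent: the supremum (in the extended reals, possibly `⊤`)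
of all real `w` for which the dual system is solvable for an unbounded set of `Q`. -/
noncomputable def dualExponent (n : ℕ) (ξ : ℝ) : EReal :=
  ⨆ (w : ℝ) (_ : ∃ᶠ Q : ℝ in atTop, DualSolvable n ξ w Q), (w : EReal)

/-- `δ_k = k / (ω_k(ξ) + 1 - k)`, which is `0` when `ω_k(ξ) = ⊤`. -/
noncomputable def deltaExponent (k : ℕ) (ξ : ℝ) : EReal :=
  (k : EReal) / (dualExponent k ξ + 1 - (k : EReal))

/-!
Let `δ` be the value of `deltaExponent k ξ`. Every bound is a case of one estimate: if `m ≥ k` and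
`n = 2 * m + 1 + t` with `t ≥ 0`, then the uniform exponent is at most `1 / (m + 1 + min δ t)`
(`uniformSimultaneousExponent_le`). The choices are `m = k` for `n < 2 * k + 1 + δ`, and the ceiling
and the floor of `(n - δ - 1) / 2` for the two terms of the minimum. When `ω_k(ξ) = k`, so that
`δ = k`, the larger of `k` and the integer part of `(n - k - 1) / 2` gives the asymptotic bound.

A polynomial `P`, read as a form of degree `d ≤ n`, sends an integer point `(x 0, …, x n)` to the
point with coordinates `∑ c, P.coeff c * x (v + c)`, `v ≤ n - d`; it annihilates `x` when the image
vanishes. For a point within `L` of the line through `(1, ξ, …, ξ ^ n)` the image is, up to an error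
`O(H(P) L)`, the multiple `x 0 * P(ξ)` of `(1, ξ, …, ξ ^ (n - d))`. Forms annihilating given points
are orthogonal to truncated shifts of these points. The minors of such shifts are small, as all
columns are nearly proportional, and the sharp Siegel lemma `exists_int_vec_orthogonal` then gives
short annihilators (`exists_short_polynomial`). For a single point and degree `k` this is
Khintchine's transference principle: a point within `L` of the line through `(1, ξ, …, ξ ^ k)` has
height `≫ L ^ (-δ')` for each `δ' < δ` (`exists_lower_bound_of_not_dualSolvable`).

If the uniform exponent exceeds `1 / w`, points `x i` of least height within `L i` of the line, for a
geometric sequence `L i`, satisfy `|x (i + 1) 0| * L i ^ w → 0`. For `w ≤ n - m` only finitely many of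
them are annihilated by a form of degree at most `m`
(`IsApproximationSequence.eventually_not_annihilates`); this rests on a height bound for the minimal
annihilator, through a divisibility argument and Gelfond's inequality. Now take
`w = m + 1 + δ'` with `δ' ≤ t`, and let `Q` be a shortest form of degree `n - m` that annihilates
`x i`, for a large `i`. It annihilates `x i, …, x j` and not `x (j + 1)`, for some `j ≥ i`. The image
of `x (j + 1)` lies so close to the line that its first coordinate is nonzero, and the transference
bound applies to it because `k ≤ m`. On the other side, `x j` being annihilated makes `Q(ξ)` small.
What is needed is that `Q` is about as short as a form chosen for `x j`, that is,
`H(Q) ^ (1 + δ') ≪ |x j 0| * L j ^ m`. Siegel's lemma applied to the span of all shifts of `x i` and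
`x j` together gives a short common annihilator (`exists_short_common_annihilator`), whose height is
at least `H(Q)` by minimality; as `H(Q) * L i ≤ 1` and `δ' ≤ t`, its height bound implies this one.
The resulting inequality `|x (j + 1) 0| * L j ^ w ≫ 1` is the contradiction.
-/

/-! ### Determinants and Siegel's lemma -/

/-- Hadamard-type bound for a matrix whose columns are all close to multiples of the `k`-th one:
in the Leibniz expansion, after clearing multiples of that column, only one factor is large. -/
theorem abs_det_le_of_cols_close {κ : Type*} [Fintype κ] [DecidableEq κ] (A : Matrix κ κ ℝ)
    (k : κ) (b : κ → ℝ) (X P : ℝ) (ε : κ → ℝ)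
    (hk : ∀ l, |A l k| ≤ X) (hb : ∀ l c, |A l c - b c * A l k| ≤ ε l)
    (hP : ∀ l, ∏ l' ∈ Finset.univ.erase l, ε l' ≤ P) :
    |A.det| ≤ (Fintype.card κ).factorial * (X * P) := by
  classical
  set B : Matrix κ κ ℝ := fun l c => if c = k then A l k else A l c - b c * A l k with hB
  have hε : ∀ l, 0 ≤ ε l := fun l => (abs_nonneg _).trans (hb l k)
  have hX : 0 ≤ X := (abs_nonneg _).trans (hk k)
  have hdet : A.det = B.det := by
    rw [← Matrix.det_transpose A, ← Matrix.det_transpose B]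
    refine Matrix.det_eq_of_forall_row_eq_smul_add_const (fun c => if c = k then 0 else b c) k
      (by simp) ?_
    intro c l
    simp only [Matrix.transpose_apply]
    by_cases h : c = k
    · simp [hB, h]
    · simp [hB, h]
  rw [hdet, Matrix.det_apply]
  refine (Finset.abs_sum_le_sum_abs _ _).trans ?_
  have : ∀ σ ∈ (Finset.univ : Finset (Equiv.Perm κ)),
      |Equiv.Perm.sign σ • ∏ i, B (σ i) i| ≤ X * P := by
    intro σ _
    have h1 : |Equiv.Perm.sign σ • ∏ i, B (σ i) i| = |∏ i, B (σ i) i| := by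
      rcases Int.units_eq_one_or (Equiv.Perm.sign σ) with h | h <;> simp [h]
    rw [h1, Finset.abs_prod, ← Finset.mul_prod_erase _ _ (Finset.mem_univ k)]
    refine mul_le_mul ?_ ?_ (Finset.prod_nonneg fun _ _ => abs_nonneg _) hX
    · simpa [hB] using hk (σ k)
    · calc ∏ i ∈ Finset.univ.erase k, |B (σ i) i|
          ≤ ∏ i ∈ Finset.univ.erase k, ε (σ i) := by
            refine Finset.prod_le_prod (fun _ _ => abs_nonneg _) fun i hi => ?_
            have : i ≠ k := Finset.ne_of_mem_erase hi
            simpa [hB, this] using hb (σ i) i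
        _ = ∏ l ∈ Finset.univ.erase (σ k), ε l := by
            refine Finset.prod_bij (fun i _ => σ i) ?_ ?_ ?_ ?_ <;> simp
            intro b hb
            exact ⟨σ.symm b, fun h => hb (by rw [← h]; simp), by simp⟩
        _ ≤ P := hP _
  refine (Finset.sum_le_sum this).trans ?_
  simp [Finset.card_univ, Fintype.card_perm]

theorem exists_det_submatrix_ne_zero {κ ι : Type*} [Fintype κ] [Fintype ι] [DecidableEq κ]
    (u : Matrix κ ι ℤ) (hu : LinearIndependent ℚ fun l c => (u l c : ℚ)) :
    ∃ f : κ → ι, (u.submatrix id f).det ≠ 0 := by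
  classical
  set M : Matrix κ ι ℚ := fun l c => (u l c : ℚ) with hM
  have hrank : M.rank = Fintype.card κ := LinearIndependent.rank_matrix hu
  obtain ⟨κ', a, ha, hsp, hli⟩ := exists_linearIndependent' ℚ M.col
  have hfin : Finite κ' := Finite.of_injective a ha
  have := Fintype.ofFinite κ'
  have hcard : Fintype.card κ' = Fintype.card κ := by
    rw [← hrank, Matrix.rank_eq_finrank_span_cols, ← hsp, finrank_span_eq_card hli]
  let e : κ ≃ κ' := Fintype.equivOfCardEq hcard.symm
  refine ⟨a ∘ e, fun h0 => ?_⟩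
  have h1 : LinearIndependent ℚ (M.submatrix id (a ∘ e)).col := by
    have := hli.comp e e.injective
    exact this
  rw [Matrix.linearIndependent_cols_iff_isUnit, Matrix.isUnit_iff_isUnit_det] at h1
  have h2 : (M.submatrix id (a ∘ e)).det = (((u.submatrix id (a ∘ e)).det : ℤ) : ℚ) := by
    rw [Int.cast_det]; rfl
  rw [h2, h0] at h1
  simp at h1

/-- The image lattice of a nonsingular integer matrix has index `|det A|`. -/
theorem card_quotient_range_mulVecLin {κ : Type*} [Fintype κ] [DecidableEq κ] (A : Matrix κ κ ℤ)
    (hA : A.det ≠ 0) :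
    Nat.card ((κ → ℤ) ⧸ LinearMap.range A.mulVecLin) = A.det.natAbs := by
  have hinj : Function.Injective A.mulVecLin := by
    rw [Matrix.coe_mulVecLin]; exact Matrix.mulVec_injective_of_det_ne_zero hA
  have := Submodule.natAbs_det_equiv (LinearMap.range A.mulVecLin)
    (LinearEquiv.ofInjective A.mulVecLin hinj)
  rw [← this]
  have h2 : ((LinearMap.range A.mulVecLin).subtype ∘ₗ AddMonoidHom.toIntLinearMap
      ((LinearEquiv.ofInjective A.mulVecLin hinj : (κ → ℤ) ≃ₗ[ℤ] _) : (κ → ℤ) →+ _)) =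
      A.mulVecLin := by
    ext; simp
  rw [h2, ← Matrix.toLin'_apply', LinearMap.det_toLin']

/-- A sharp form of Siegel's lemma: integer rows `u`, linearly independent and with all maximal
minors at most `D`, are annihilated by a nonzero integer vector of height `≪ D ^ (1 / (N - r))`.
A largest minor `Δ` is singled out; the pigeonhole principle modulo the image lattice of its matrix,
of index `Δ`, controls the `N - r` remaining coordinates, and Cramer's rule the others. -/
theorem exists_int_vec_orthogonal {κ ι : Type*} [Fintype κ] [Fintype ι] [DecidableEq κ]
    (u : Matrix κ ι ℤ) (hu : LinearIndependent ℚ fun l c => (u l c : ℚ))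
    (hcard : Fintype.card κ < Fintype.card ι) (D : ℝ)
    (hD : ∀ f : κ → ι, |((u.submatrix id f).det : ℝ)| ≤ D) :
    ∃ q : ι → ℤ, q ≠ 0 ∧ u.mulVec q = 0 ∧
      ∀ c, |(q c : ℝ)| ^ (Fintype.card ι - Fintype.card κ) ≤
        (Fintype.card ι : ℝ) ^ (Fintype.card ι) * D := by
  classical
  obtain ⟨f₀, hf₀⟩ := exists_det_submatrix_ne_zero u hu
  have : Nonempty (κ → ι) := ⟨f₀⟩
  obtain ⟨f, hf⟩ := Finite.exists_max (fun f : κ → ι => (u.submatrix id f).det.natAbs)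
  set A := u.submatrix id f with hAdef
  have hA : A.det ≠ 0 := by
    have := hf f₀
    intro h
    rw [h] at this
    simp at this
    exact hf₀ this
  have hfinj : Function.Injective f := by
    intro a b hab
    by_contra hne
    exact hA (Matrix.det_zero_of_column_eq hne fun i => by simp [hAdef, hab])
  -- the free coordinates
  let F := {c : ι // c ∉ Set.range f}
  have hFcard : Fintype.card F = Fintype.card ι - Fintype.card κ := by
    have h1 : Fintype.card F = Fintype.card ι - Fintype.card {c // c ∈ Set.range f} :=
      Fintype.card_subtype_compl _
    rw [h1]
    congr 1
    exact (Fintype.card_congr (Equiv.ofInjective f hfinj)).symm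
  set e := Fintype.card ι - Fintype.card κ with he
  have hepos : e ≠ 0 := by omega
  -- largest integer `T` with `T ^ e ≤ Δ`
  set Δ := A.det.natAbs with hΔ
  obtain ⟨T, hT1, hT2⟩ : ∃ T : ℕ, T ^ e ≤ Δ ∧ Δ < (T + 1) ^ e := by
    have hex : ∃ T : ℕ, Δ < (T + 1) ^ e := ⟨Δ, lt_of_lt_of_le (Nat.lt_succ_self _)
      (Nat.le_self_pow hepos _)⟩
    refine ⟨Nat.find hex, ?_, Nat.find_spec hex⟩
    by_contra hlt
    push Not at hlt
    rcases Nat.eq_zero_or_pos (Nat.find hex) with h0 | h0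
    · rw [h0, zero_pow hepos] at hlt; omega
    · exact Nat.find_min hex (Nat.sub_lt h0 one_pos)
        (by rwa [Nat.sub_add_cancel (Nat.one_le_iff_ne_zero.2 h0.ne')])
  let Bm : Matrix κ F ℤ := u.submatrix id Subtype.val
  let Φ : (F → Fin (T + 1)) → ((κ → ℤ) ⧸ LinearMap.range A.mulVecLin) :=
    fun y => Submodule.Quotient.mk (Bm.mulVec fun c => ((y c : ℕ) : ℤ))
  have hidx := card_quotient_range_mulVecLin A hA
  have hfinQ : Finite ((κ → ℤ) ⧸ LinearMap.range A.mulVecLin) := by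
    apply Nat.finite_of_card_ne_zero
    rw [hidx]; exact Int.natAbs_ne_zero.2 hA
  have := Fintype.ofFinite ((κ → ℤ) ⧸ LinearMap.range A.mulVecLin)
  obtain ⟨y, y', hyy, hΦ⟩ := Fintype.exists_ne_map_eq_of_card_lt Φ (by
    rw [← Nat.card_eq_fintype_card, hidx]
    simp only [Fintype.card_fun, Fintype.card_fin, hFcard]
    exact hT2)
  set w : F → ℤ := fun c => ((y c : ℕ) : ℤ) - ((y' c : ℕ) : ℤ) with hw
  have hwT : ∀ c, |w c| ≤ T := by
    intro c
    have h1 := (y c).is_lt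
    have h2 := (y' c).is_lt
    rw [abs_le]; constructor <;> simp only [hw] <;> omega
  have hw0 : ∃ c, w c ≠ 0 := by
    by_contra hcon
    push Not at hcon
    apply hyy
    funext c
    have := hcon c
    simp only [hw] at this
    apply Fin.ext; omega
  obtain ⟨z, hz⟩ : ∃ z : κ → ℤ, A.mulVec z = - Bm.mulVec w := by
    have h1 := (Submodule.Quotient.eq _).1 hΦ
    obtain ⟨z, hz⟩ := h1
    refine ⟨-z, ?_⟩
    rw [Matrix.mulVec_neg]
    congr 1
    rw [← Matrix.mulVec_sub] at hz
    exact hz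
  -- glue the two parts together
  let q : ι → ℤ := fun c => if h : c ∈ Set.range f then z h.choose else w ⟨c, h⟩
  have hqf : ∀ a, q (f a) = z a := by
    intro a
    have h : f a ∈ Set.range f := ⟨a, rfl⟩
    simp only [q, dif_pos h]
    congr 1
    exact hfinj h.choose_spec
  have hqF : ∀ c : F, q c = w c := by
    rintro ⟨c, hc⟩
    simp only [q, dif_neg hc]
  have hsum : ∀ g : ι → ℤ, ∑ c, g c = ∑ a, g (f a) + ∑ c : F, g c := by
    intro g
    have h1 := Fintype.sum_subtype_add_sum_subtype (fun c => c ∈ Set.range f) g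
    rw [← h1]
    congr 1
    refine Eq.trans ?_ (Fintype.sum_equiv (Equiv.ofInjective f hfinj) (fun a => g (f a))
      (fun c => g c) (fun a => by simp)).symm
    exact Finset.sum_congr (by ext; simp) fun _ _ => rfl
  refine ⟨q, ?_, ?_, ?_⟩
  · obtain ⟨c, hc⟩ := hw0
    intro h
    apply hc
    rw [← hqF, h]; rfl
  · funext l
    have h1 := congrFun hz l
    simp only [Matrix.mulVec, dotProduct, hAdef, Bm, Matrix.submatrix_apply, id_eq,
      Pi.neg_apply] at h1
    simp only [Matrix.mulVec, dotProduct, Pi.zero_apply]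
    rw [hsum]
    simp only [hqf, hqF]
    linarith
  · -- Cramer's rule with the maximality of `Δ`
    have hΔ0 : 0 < Δ := Int.natAbs_pos.2 hA
    have hzb : ∀ a, |z a| ≤ Fintype.card ι * T := by
      intro a
      have h1 : A.det * z a = (A.updateCol a (-Bm.mulVec w)).det := by
        have h2 : A.cramer (A.mulVec z) = A.det • z := by
          rw [Matrix.cramer_eq_adjugate_mulVec, Matrix.mulVec_mulVec, Matrix.adjugate_mul,
            Matrix.smul_mulVec, Matrix.one_mulVec]
        have h3 := congrFun h2 a
        rw [hz, Matrix.cramer_apply] at h3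
        simpa using h3.symm
      have h4 : (A.updateCol a (-Bm.mulVec w)).det =
          - ∑ c : F, w c * (A.updateCol a (fun l => u l c)).det := by
        have h5 : -Bm.mulVec w = ∑ c : F, (- w c) • (fun l => u l c) := by
          funext l
          simp [Matrix.mulVec, dotProduct, Bm, Finset.sum_apply, mul_comm]
        rw [← Matrix.cramer_apply, h5, map_sum]
        simp only [Finset.sum_apply, map_smul, Pi.smul_apply, Matrix.cramer_apply, smul_eq_mul,
          neg_mul, Finset.sum_neg_distrib]
      have h6 : ∀ c : F, |(A.updateCol a (fun l => u l c)).det| ≤ Δ := by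
        intro c
        have h7 : A.updateCol a (fun l => u l c) = u.submatrix id (Function.update f a c) := by
          ext l b
          by_cases hb : b = a
          · subst hb; simp
          · simp [hb, hAdef]
        rw [h7, Int.abs_eq_natAbs]
        exact_mod_cast hf _
      have h8 : |A.det * z a| ≤ Fintype.card ι * T * Δ := by
        rw [h1, h4, abs_neg]
        refine (Finset.abs_sum_le_sum_abs _ _).trans ?_
        calc ∑ c : F, |w c * (A.updateCol a (fun l => u l c)).det|
            ≤ ∑ _c : F, (T : ℤ) * Δ := by
              refine Finset.sum_le_sum fun c _ => ?_
              rw [abs_mul]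
              exact mul_le_mul (hwT c) (h6 c) (abs_nonneg _) (by positivity)
          _ = (Fintype.card F : ℤ) * (T * Δ) := by simp [Finset.card_univ]
          _ ≤ Fintype.card ι * (T * Δ) := by
              gcongr
              exact Fintype.card_subtype_le _
          _ = _ := by ring
      rw [abs_mul, Int.abs_eq_natAbs A.det] at h8
      have h9 : (0 : ℤ) < Δ := by exact_mod_cast hΔ0
      have : (Δ : ℤ) * |z a| ≤ Δ * (Fintype.card ι * T) := by
        calc (Δ : ℤ) * |z a| ≤ _ := h8
          _ = _ := by ring
      exact le_of_mul_le_mul_left this h9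
    have hι : 1 ≤ Fintype.card ι := by omega
    have hqb : ∀ c, |q c| ≤ Fintype.card ι * T := by
      intro c
      by_cases hc : c ∈ Set.range f
      · obtain ⟨a, rfl⟩ := hc
        rw [hqf]; exact hzb a
      · have := hqF ⟨c, hc⟩
        simp only at this
        rw [this]
        refine (hwT _).trans ?_
        have : (1 : ℤ) ≤ Fintype.card ι := by exact_mod_cast hι
        nlinarith
    intro c
    have h1 : |(q c : ℝ)| ≤ Fintype.card ι * T := by exact_mod_cast hqb c
    have h2 : ((T : ℝ)) ^ e ≤ D := by
      refine le_trans ?_ (hD f)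
      rw [← Int.cast_abs, Int.abs_eq_natAbs]
      exact_mod_cast hT1
    calc |(q c : ℝ)| ^ e ≤ (Fintype.card ι * T : ℝ) ^ e := by gcongr
      _ = (Fintype.card ι : ℝ) ^ e * (T : ℝ) ^ e := by rw [mul_pow]
      _ ≤ (Fintype.card ι : ℝ) ^ (Fintype.card ι) * D := by
        gcongr
        · exact_mod_cast hι
        · omega

/-! ### Forms acting on integer points near the curve -/

/-- The linear functional on `ℤ[X]` that sends `X ^ c` to `x c`. -/
noncomputable def momentPairing (x : ℕ → ℤ) : Polynomial ℤ →ₗ[ℤ] ℤ :=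
  Polynomial.lsum fun c => LinearMap.toSpanSingleton ℤ ℤ (x c)

/-- The sequence `x` with its first `v` terms dropped. -/
def shift (v : ℕ) (x : ℕ → ℤ) : ℕ → ℤ := fun c => x (v + c)

/-- `P`, regarded as a form of degree `d`, is a linear recurrence relation satisfied by the finite
sequence `x 0, …, x n`. -/
def Annihilates (n d : ℕ) (x : ℕ → ℤ) (P : Polynomial ℤ) : Prop :=
  ∀ v, v + d ≤ n → momentPairing (shift v x) P = 0

/-- The point `(x 0, …, x n)` lies within `L` of `x 0 • (1, ξ, …, ξ ^ n)` in sup norm. -/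
def IsClose (n : ℕ) (ξ : ℝ) (x : ℕ → ℤ) (L : ℝ) : Prop :=
  ∀ l, l ≤ n → |(x 0 : ℝ) * ξ ^ l - x l| ≤ L

theorem momentPairing_eq_sum (x : ℕ → ℤ) (P : Polynomial ℤ) {d : ℕ} (hP : P.natDegree ≤ d) :
    momentPairing x P = ∑ c ∈ Finset.range (d + 1), P.coeff c * x c := by
  rw [momentPairing, Polynomial.lsum_apply]
  exact Polynomial.sum_over_range' P (by simp) _ (Nat.lt_succ_of_le hP)

theorem momentPairing_shift_X_pow_mul (x : ℕ → ℤ) (v l : ℕ) (P : Polynomial ℤ) :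
    momentPairing (shift v x) (Polynomial.X ^ l * P) = momentPairing (shift (v + l) x) P := by
  induction P using Polynomial.induction_on' with
  | add p q hp hq => rw [mul_add, map_add, map_add, hp, hq]
  | monomial i a =>
    rw [Polynomial.X_pow_mul_monomial]
    simp only [momentPairing, Polynomial.lsum_apply]
    rw [Polynomial.sum_monomial_index _ _ (by simp), Polynomial.sum_monomial_index _ _ (by simp)]
    simp only [LinearMap.toSpanSingleton_apply, shift]
    congr 2
    omega

theorem IsClose.mono {n : ℕ} {ξ : ℝ} {x : ℕ → ℤ} {L L' : ℝ} (h : IsClose n ξ x L) (hL : L ≤ L') :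
    IsClose n ξ x L' := fun l hl => (h l hl).trans hL

theorem abs_coeff_le_supNorm (P : Polynomial ℤ) (c : ℕ) : |(P.coeff c : ℝ)| ≤ P.supNorm := by
  have := P.le_supNorm c
  rwa [Int.norm_eq_abs] at this

theorem supNorm_le_of_forall (P : Polynomial ℤ) (H : ℝ) (h : ∀ c, |(P.coeff c : ℝ)| ≤ H) :
    P.supNorm ≤ H := by
  obtain ⟨i, hi⟩ := P.exists_eq_supNorm
  rw [hi, Int.norm_eq_abs]; exact h i

theorem one_le_supNorm {P : Polynomial ℤ} (hP : P ≠ 0) : 1 ≤ P.supNorm := by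
  refine le_trans ?_ (abs_coeff_le_supNorm P P.natDegree)
  rw [← Int.cast_abs]
  exact_mod_cast Int.one_le_abs (Polynomial.leadingCoeff_ne_zero.2 hP)

/-- Pairing with a point close to the curve is nearly evaluation at `ξ`. -/
theorem abs_momentPairing_sub_le {n d : ℕ} {ξ : ℝ} {x : ℕ → ℤ} {L : ℝ} (hx : IsClose n ξ x L)
    (P : Polynomial ℤ) (hP : P.natDegree ≤ d) {v : ℕ} (hv : v + d ≤ n) :
    |(momentPairing (shift v x) P : ℝ) - x 0 * ξ ^ v * Polynomial.aeval ξ P| ≤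
      (n + 1) * P.supNorm * L := by
  have hL : 0 ≤ L := (abs_nonneg _).trans (hx 0 (Nat.zero_le _))
  rw [momentPairing_eq_sum _ _ hP, Polynomial.aeval_eq_sum_range' (Nat.lt_succ_of_le hP)]
  push_cast
  rw [Finset.mul_sum, ← Finset.sum_sub_distrib]
  refine (Finset.abs_sum_le_sum_abs _ _).trans ?_
  have : ∀ c ∈ Finset.range (d + 1),
      |(P.coeff c : ℝ) * (shift v x c : ℝ) - x 0 * ξ ^ v * (P.coeff c • ξ ^ c)| ≤
        P.supNorm * L := by
    intro c hc
    have hc' := Finset.mem_range.1 hc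
    have h1 : (P.coeff c : ℝ) * (shift v x c : ℝ) - x 0 * ξ ^ v * (P.coeff c • ξ ^ c) =
        - (P.coeff c * (x 0 * ξ ^ (v + c) - x (v + c))) := by
      rw [zsmul_eq_mul, pow_add]; simp only [shift]; ring
    rw [h1, abs_neg, abs_mul]
    exact mul_le_mul (abs_coeff_le_supNorm P c) (hx _ (by omega)) (abs_nonneg _)
      P.supNorm_nonneg
  refine (Finset.sum_le_sum this).trans ?_
  rw [Finset.sum_const, Finset.card_range, nsmul_eq_mul]
  have : ((d + 1 : ℕ) : ℝ) ≤ n + 1 := by exact_mod_cast (by omega : d + 1 ≤ n + 1)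
  have h2 := mul_nonneg P.supNorm_nonneg hL
  nlinarith

/-- A point annihilated by `P` forces `P` to be small at `ξ`. -/
theorem Annihilates.abs_aeval_le {n d : ℕ} {ξ : ℝ} {x : ℕ → ℤ} {L : ℝ} (hx : IsClose n ξ x L)
    {P : Polynomial ℤ} (hP : P.natDegree ≤ d) (hd : d ≤ n) (h : Annihilates n d x P) :
    |(x 0 : ℝ)| * |Polynomial.aeval ξ P| ≤ (n + 1) * P.supNorm * L := by
  have h1 := abs_momentPairing_sub_le hx P hP (v := 0) (by omega)
  rw [h 0 (by omega)] at h1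
  simpa [abs_mul] using h1

theorem aeval_ne_zero_of_transcendental {ξ : ℝ} (hξ : Transcendental ℚ ξ) {P : Polynomial ℤ}
    (hP : P ≠ 0) : Polynomial.aeval ξ P ≠ 0 := fun h0 =>
  hξ (IsAlgebraic.extendScalars (R := ℤ) (S := ℚ) (Int.castRingHom ℚ).injective_int ⟨P, hP, h0⟩)

theorem Annihilates.primPart {n d : ℕ} {x : ℕ → ℤ} {P : Polynomial ℤ} (hP : P ≠ 0)
    (h : Annihilates n d x P) : Annihilates n d x P.primPart := by
  intro v hv
  have h1 := h v hv
  rw [P.eq_C_content_mul_primPart, ← Polynomial.smul_eq_C_mul, map_smul, smul_eq_mul] at h1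
  exact (mul_eq_zero.1 h1).resolve_left (mt Polynomial.content_eq_zero_iff.1 hP)

/-- Gelfond's inequality for an integer divisor, through the Mahler measure. -/
theorem supNorm_le_of_mul {P S : Polynomial ℤ} (hP : P ≠ 0) (hS : S ≠ 0) {N : ℕ}
    (hN : (P * S).natDegree ≤ N) :
    P.supNorm ≤ 2 ^ N * (N + 1) * (P * S).supNorm := by
  set v := Int.castRingHom ℂ
  have hinj : Function.Injective v := v.injective_int
  refine supNorm_le_of_forall _ _ fun c => ?_
  have h1 := Polynomial.norm_coeff_le_choose_mul_mahlerMeasure_of_one_le_mahlerMeasure c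
    (P.map v) (S.map v) (Polynomial.one_le_mahlerMeasure_of_ne_zero hS)
  rw [← Polynomial.map_mul, Polynomial.natDegree_map_eq_of_injective hinj,
    Polynomial.coeff_map] at h1
  have h2 : ‖v (P.coeff c)‖ = |(P.coeff c : ℝ)| := by simp [v]
  rw [h2] at h1
  have h3 : ((P * S).map v).mahlerMeasure ≤ (N + 1) * (P * S).supNorm := by
    refine (Polynomial.mahlerMeasure_le_sum_norm_coeff _).trans ?_
    rw [Polynomial.sum_over_range' _ (by simp) (N + 1)
      (by rw [Polynomial.natDegree_map_eq_of_injective hinj]; omega)]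
    refine (Finset.sum_le_sum (g := fun _ => (P * S).supNorm) fun i _ => ?_).trans ?_
    · rw [Polynomial.coeff_map]
      have h4 : ‖v ((P * S).coeff i)‖ = |((P * S).coeff i : ℝ)| := by
        simp only [v, eq_intCast, Complex.norm_intCast]
      rw [h4]
      exact abs_coeff_le_supNorm _ _
    · simp
  have hPN : P.natDegree ≤ N := by
    rw [Polynomial.natDegree_mul hP hS] at hN; omega
  have h5 : ((P.natDegree.choose c : ℕ) : ℝ) ≤ 2 ^ N := by
    exact_mod_cast (Nat.choose_le_two_pow _ _).trans (Nat.pow_le_pow_right (by norm_num) hPN)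
  calc |(P.coeff c : ℝ)| ≤ _ := h1
    _ ≤ 2 ^ N * ((N + 1) * (P * S).supNorm) := by
      gcongr
      exact Polynomial.mahlerMeasure_nonneg _
    _ = _ := by ring

theorem linearIndependent_shifts {n m : ℕ} (hm : m ≤ n) (x : ℕ → ℤ)
    (h : ∀ P : Polynomial ℤ, P ≠ 0 → P.natDegree ≤ m → ¬ Annihilates n m x P) :
    LinearIndependent ℚ fun (v : Fin (m + 1)) (c : Fin (n - m + 1)) =>
      (shift v x c : ℚ) := by
  have hZ : LinearIndependent ℤ fun (v : Fin (m + 1)) (c : Fin (n - m + 1)) => shift v x c := by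
    rw [Fintype.linearIndependent_iff]
    intro a ha
    by_contra hcon
    push Not at hcon
    obtain ⟨i, hi⟩ := hcon
    set P : Polynomial ℤ := ∑ v : Fin (m + 1), Polynomial.monomial (v : ℕ) (a v) with hP
    have hcoeff : ∀ v : Fin (m + 1), P.coeff v = a v := by
      intro v
      rw [hP, Polynomial.finsetSum_coeff]
      simp [Polynomial.coeff_monomial, Fin.val_inj]
    have hdeg : P.natDegree ≤ m := by
      refine Polynomial.natDegree_sum_le_of_forall_le _ _ fun v _ => ?_
      exact (Polynomial.natDegree_monomial_le _).trans (Nat.lt_succ_iff.1 v.is_lt)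
    refine h P (fun h0 => hi (by rw [← hcoeff, h0]; simp)) hdeg ?_
    intro w hw
    rw [momentPairing_eq_sum _ _ hdeg, Finset.sum_range fun c => P.coeff c * shift w x c]
    have := congrFun ha ⟨w, by omega⟩
    simp only [Finset.sum_apply, Pi.smul_apply, smul_eq_mul, Pi.zero_apply] at this
    rw [← this]
    refine Finset.sum_congr rfl fun v _ => ?_
    rw [hcoeff]
    simp only [shift]
    rw [add_comm]
  have h2 := hZ.map_injOn (LinearMap.compLeft (Algebra.linearMap ℤ ℚ) (Fin (n - m + 1)))
    (by
      intro a _ b _ hab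
      funext c
      have := congrFun hab c
      simpa using this)
  rw [LinearIndependent.iff_fractionRing ℤ ℚ] at h2
  exact h2

/-! ### Short forms orthogonal to shifts -/

/-- Linearly independent truncated shifts of points close to the curve are annihilated by a short
polynomial: the determinant bound makes the minors in Siegel's lemma small. -/
theorem exists_short_polynomial (n : ℕ) (ξ : ℝ) (hξ : ξ ≠ 0) :
    ∃ C : ℝ, 1 ≤ C ∧ ∀ (κ : Type) [Fintype κ] [DecidableEq κ] [Nonempty κ] (d : ℕ) (v : κ → ℕ)
      (y : κ → ℕ → ℤ) (ε : κ → ℝ) (X P : ℝ), (∀ l, v l + d ≤ n) →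
      (∀ l, IsClose n ξ (y l) (ε l)) → (∀ l, ε l ≤ 1) → 1 ≤ X → (∀ l, |(y l 0 : ℝ)| ≤ X) →
      (∀ l, ∏ l' ∈ Finset.univ.erase l, ε l' ≤ P) →
      LinearIndependent ℚ (fun l (c : Fin (d + 1)) => (shift (v l) (y l) c : ℚ)) →
      Fintype.card κ < d + 1 →
      ∃ Q : Polynomial ℤ, Q ≠ 0 ∧ Q.natDegree ≤ d ∧
        (∀ l, momentPairing (shift (v l) (y l)) Q = 0) ∧
        Q.supNorm ^ (d + 1 - Fintype.card κ) ≤ C * (X * P) := by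
  set B : ℝ := 1 + |ξ| + |ξ|⁻¹ with hB
  have hξ0 : 0 < |ξ| := abs_pos.2 hξ
  have hB1 : 1 ≤ B := by
    have := inv_pos.2 hξ0
    rw [hB]; linarith
  have hξB : |ξ| ≤ B := by
    have := inv_pos.2 hξ0
    rw [hB]; linarith
  have hξB' : |ξ|⁻¹ ≤ B := by rw [hB]; linarith
  set R : ℝ := B ^ (2 * n) with hR
  have hR1 : 1 ≤ R := one_le_pow₀ hB1
  refine ⟨(n + 1 : ℝ) ^ (n + 1) * ((n + 1).factorial * (2 * R * (2 * R) ^ n)), ?_, ?_⟩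
  · have h1 : (1 : ℝ) ≤ (n + 1 : ℝ) ^ (n + 1) := one_le_pow₀ (by
      have : (0 : ℝ) ≤ n := Nat.cast_nonneg n
      linarith)
    have h2 : (1 : ℝ) ≤ ((n + 1).factorial : ℝ) := by exact_mod_cast Nat.factorial_pos _
    have h3 : (1 : ℝ) ≤ (2 * R) ^ n := one_le_pow₀ (by linarith)
    have h4 : (1 : ℝ) ≤ 2 * R * (2 * R) ^ n := by nlinarith
    exact one_le_mul_of_one_le_of_one_le h1 (one_le_mul_of_one_le_of_one_le h2 h4)
  intro κ _ _ _ d v y ε X P hv hy hε1 hX1 hyX hP hli hcard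
  have hpow : ∀ a ≤ n, |ξ| ^ a ≤ B ^ n := fun a ha =>
    (pow_le_pow_left₀ hξ0.le hξB a).trans (pow_le_pow_right₀ hB1 ha)
  have hpowR : ∀ a ≤ n, |ξ| ^ a ≤ R := fun a ha =>
    (hpow a ha).trans (pow_le_pow_right₀ hB1 (by omega))
  have hpow' : ∀ a ≤ n, (|ξ| ^ a)⁻¹ ≤ B ^ n := fun a ha => by
    rw [← inv_pow]
    exact (pow_le_pow_left₀ (inv_nonneg.2 hξ0.le) hξB' a).trans (pow_le_pow_right₀ hB1 ha)
  have hε0 : ∀ l, 0 ≤ ε l := fun l => (abs_nonneg _).trans (hy l 0 (Nat.zero_le _))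
  have hP0 : 0 ≤ P := by
    obtain ⟨l⟩ := ‹Nonempty κ›
    exact (Finset.prod_nonneg fun l' _ => hε0 l').trans (hP l)
  obtain ⟨k₀⟩ := ‹Nonempty κ›
  have hdn : d ≤ n := by have := hv k₀; omega
  let u : Matrix κ (Fin (d + 1)) ℤ := fun l c => shift (v l) (y l) c
  have hdet : ∀ f : κ → Fin (d + 1), |((u.submatrix id f).det : ℝ)| ≤
      (n + 1).factorial * (2 * R * (2 * R) ^ n) * (X * P) := by
    intro f
    let A : Matrix κ κ ℝ := fun l c => (shift (v l) (y l) (f c) : ℝ)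
    have hA : ((u.submatrix id f).det : ℝ) = A.det := by
      rw [Int.cast_det]; rfl
    rw [hA]
    have h1 := abs_det_le_of_cols_close A k₀ (fun c => ξ ^ (f c : ℕ) / ξ ^ (f k₀ : ℕ))
      (2 * R * X) ((2 * R) ^ n * P) (fun l => 2 * R * ε l) ?_ ?_ ?_
    · refine h1.trans ?_
      have hc : Fintype.card κ ≤ n + 1 := by omega
      have : ((Fintype.card κ).factorial : ℝ) ≤ (n + 1).factorial := by
        exact_mod_cast Nat.factorial_le hc
      calc ((Fintype.card κ).factorial : ℝ) * (2 * R * X * ((2 * R) ^ n * P))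
          ≤ (n + 1).factorial * (2 * R * X * ((2 * R) ^ n * P)) := by gcongr
        _ = _ := by ring
    · intro l
      have hidx : v l + f k₀ ≤ n := by
        have := hv l; have := (f k₀).is_lt; omega
      have h2 := hy l _ hidx
      have h3 : |(y l 0 : ℝ) * ξ ^ (v l + f k₀)| ≤ X * R := by
        rw [abs_mul, abs_pow]
        exact mul_le_mul (hyX l) (hpowR _ hidx) (by positivity) (by linarith)
      have h4 : |A l k₀| ≤ |(y l 0 : ℝ) * ξ ^ (v l + f k₀)| +
          |(y l 0 : ℝ) * ξ ^ (v l + f k₀) - y l (v l + f k₀)| := by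
        have : A l k₀ = (y l 0 : ℝ) * ξ ^ (v l + f k₀) -
          ((y l 0 : ℝ) * ξ ^ (v l + f k₀) - y l (v l + f k₀)) := by simp [A, shift]
        rw [this]; exact abs_sub _ _
      have h5 := hε1 l
      nlinarith
    · intro l c
      have hk : v l + f k₀ ≤ n := by
        have := hv l; have := (f k₀).is_lt; omega
      have hc : v l + f c ≤ n := by
        have := hv l; have := (f c).is_lt; omega
      have h2 := hy l _ hk
      have h3 := hy l _ hc
      set r : ℝ := ξ ^ (f c : ℕ) / ξ ^ (f k₀ : ℕ) with hr
      have hrR : |r| ≤ R := by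
        rw [hr, abs_div, abs_pow, abs_pow, div_eq_mul_inv, hR, two_mul, pow_add]
        have := (f c).is_lt
        have := (f k₀).is_lt
        exact mul_le_mul (hpow _ (by omega)) (hpow' _ (by omega)) (by positivity) (by positivity)
      have h4 : A l c - r * A l k₀ =
          r * ((y l 0 : ℝ) * ξ ^ (v l + f k₀) - y l (v l + f k₀)) -
          ((y l 0 : ℝ) * ξ ^ (v l + f c) - y l (v l + f c)) := by
        have h5 : r * ξ ^ (v l + f k₀) = ξ ^ (v l + f c) := by
          rw [hr, pow_add, pow_add]; field_simp
        have h6 : r * ((y l 0 : ℝ) * ξ ^ (v l + f k₀)) = (y l 0 : ℝ) * ξ ^ (v l + f c) := by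
          rw [← h5]; ring
        simp only [A, shift]
        rw [mul_sub, h6]; ring
      rw [h4]
      refine (abs_sub _ _).trans ?_
      rw [abs_mul]
      have h7 := hε0 l
      have h8 : |r| * |(y l 0 : ℝ) * ξ ^ (v l + f k₀) - y l (v l + f k₀)| ≤ R * ε l :=
        mul_le_mul hrR h2 (abs_nonneg _) (by linarith)
      nlinarith
    · intro l
      rw [Finset.prod_mul_distrib, Finset.prod_const]
      refine mul_le_mul ?_ (hP l) (Finset.prod_nonneg fun l' _ => hε0 l') (by positivity)
      refine pow_le_pow_right₀ (by linarith) ?_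
      rw [Finset.card_erase_of_mem (Finset.mem_univ _), Finset.card_univ]
      omega
  obtain ⟨q, hq0, hqu, hqb⟩ := exists_int_vec_orthogonal u hli (by simpa using hcard) _ hdet
  rw [Fintype.card_fin] at hqb
  set Q : Polynomial ℤ := ∑ c : Fin (d + 1), Polynomial.monomial (c : ℕ) (q c) with hQ
  have hcoeff : ∀ c : Fin (d + 1), Q.coeff c = q c := by
    intro c
    rw [hQ, Polynomial.finsetSum_coeff]
    simp [Polynomial.coeff_monomial, Fin.val_inj]
  have hdeg : Q.natDegree ≤ d := by
    refine Polynomial.natDegree_sum_le_of_forall_le _ _ fun v _ => ?_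
    exact (Polynomial.natDegree_monomial_le _).trans (Nat.lt_succ_iff.1 v.is_lt)
  refine ⟨Q, ?_, hdeg, ?_, ?_⟩
  · intro h0
    apply hq0
    funext c
    rw [← hcoeff, h0]; simp
  · intro l
    rw [momentPairing_eq_sum _ _ hdeg,
      Finset.sum_range fun c => Q.coeff c * shift (v l) (y l) c]
    have := congrFun hqu l
    simp only [Matrix.mulVec, dotProduct, Pi.zero_apply, u] at this
    rw [← this]
    exact Finset.sum_congr rfl fun c _ => by rw [hcoeff, mul_comm]
  · obtain ⟨i, hi⟩ := Q.exists_eq_supNorm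
    rw [Int.norm_eq_abs] at hi
    have hnn : 0 ≤ ((n + 1).factorial * (2 * R * (2 * R) ^ n) * (X * P) : ℝ) :=
      (abs_nonneg _).trans (hdet fun _ => 0)
    have hdn' : ((d + 1 : ℕ) : ℝ) ^ (d + 1) ≤ (n + 1 : ℝ) ^ (n + 1) := by
      have h0 : ((d + 1 : ℕ) : ℝ) ≤ n + 1 := by exact_mod_cast Nat.succ_le_succ hdn
      have h1 : (1 : ℝ) ≤ n + 1 := by
        have : (0 : ℝ) ≤ n := Nat.cast_nonneg n
        linarith
      exact (pow_le_pow_left₀ (by positivity) h0 _).trans (pow_le_pow_right₀ h1 (by omega))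
    have key : ((d + 1 : ℕ) : ℝ) ^ (d + 1) *
        ((n + 1).factorial * (2 * R * (2 * R) ^ n) * (X * P)) ≤
        (n + 1 : ℝ) ^ (n + 1) * ((n + 1).factorial * (2 * R * (2 * R) ^ n)) * (X * P) := by
      rw [mul_assoc ((n + 1 : ℝ) ^ (n + 1))]
      exact mul_le_mul_of_nonneg_right hdn' hnn
    rw [hi]
    by_cases hid : i < d + 1
    · have := hqb ⟨i, hid⟩
      rw [← hcoeff ⟨i, hid⟩] at this
      exact this.trans key
    · rw [Polynomial.coeff_eq_zero_of_natDegree_lt (by omega)]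
      rw [Int.cast_zero, abs_zero, zero_pow (by omega)]
      exact (mul_nonneg (by positivity) hnn).trans key

/-- A polynomial `P` of degree at most `g + 1` annihilating `x`, while none of degree at most `g`
does, generates all relations of the truncated shifts of `x`: its multiples fill the orthogonal
complement, by a dimension count. -/
theorem dvd_of_annihilates {n g : ℕ} (hg : 2 * g + 1 ≤ n) {x : ℕ → ℤ}
    (hmin : ∀ P : Polynomial ℤ, P ≠ 0 → P.natDegree ≤ g → ¬ Annihilates n g x P)
    {P : Polynomial ℤ} (hP0 : P ≠ 0) (hP : P.natDegree ≤ g + 1) (hPx : Annihilates n (g + 1) x P)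
    {Q : Polynomial ℤ} (hQ : Q.natDegree ≤ n - g)
    (hQx : ∀ v ≤ g, momentPairing (shift v x) Q = 0) :
    P.map (Int.castRingHom ℚ) ∣ Q.map (Int.castRingHom ℚ) := by
  classical
  let M : Matrix (Fin (g + 1)) (Fin (n - g + 1)) ℚ := fun v c => (shift v x c : ℚ)
  have hM : M.rank = g + 1 := by
    have := LinearIndependent.rank_matrix (M := M) (linearIndependent_shifts (by omega) x hmin)
    simpa using this
  set K := LinearMap.ker M.mulVecLin with hK
  have hKdim : Module.finrank ℚ K = n - 2 * g := by
    have h1 : Module.finrank ℚ (LinearMap.range M.mulVecLin) + Module.finrank ℚ K =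
        Module.finrank ℚ (Fin (n - g + 1) → ℚ) :=
      LinearMap.finrank_range_add_finrank_ker M.mulVecLin
    have h2 : Module.finrank ℚ (LinearMap.range M.mulVecLin) = g + 1 := hM
    rw [Module.finrank_fin_fun, h2] at h1
    omega
  have hker : ∀ F : Polynomial ℤ, F.natDegree ≤ n - g →
      (∀ v ≤ g, momentPairing (shift v x) F = 0) →
      (fun c : Fin (n - g + 1) => (F.coeff c : ℚ)) ∈ K := by
    intro F hF hFx
    rw [hK, LinearMap.mem_ker]
    funext v
    have h1 := hFx v (Nat.lt_succ_iff.1 v.is_lt)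
    rw [momentPairing_eq_sum _ _ hF, Finset.sum_range fun c => F.coeff c * shift v x c] at h1
    have h2 : ((∑ c : Fin (n - g + 1), F.coeff c * shift v x c : ℤ) : ℚ) = 0 := by
      rw [h1]; simp
    push_cast at h2
    rw [Matrix.mulVecLin_apply, Pi.zero_apply, ← h2]
    simp only [Matrix.mulVec, dotProduct, M]
    exact Finset.sum_congr rfl fun c _ => mul_comm _ _
  set p := P.map (Int.castRingHom ℚ) with hp
  have hp0 : p ≠ 0 := (Polynomial.map_ne_zero_iff (Int.castRingHom ℚ).injective_int).2 hP0
  -- multiplication by `P`, from `ℚ ^ (n - 2 g)` to the kernel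
  let G : Fin (n - 2 * g) → (Fin (n - g + 1) → ℚ) :=
    fun l c => ((Polynomial.X ^ (l : ℕ) * P).coeff c : ℚ)
  have hGdeg : ∀ l : Fin (n - 2 * g), (Polynomial.X ^ (l : ℕ) * P).natDegree ≤ n - g := by
    intro l
    have := l.is_lt
    refine Polynomial.natDegree_mul_le.trans ?_
    rw [Polynomial.natDegree_X_pow]
    omega
  have hGK : ∀ l, G l ∈ K := by
    intro l
    refine hker _ (hGdeg l) fun v hv => ?_
    have := l.is_lt
    rw [momentPairing_shift_X_pow_mul]
    exact hPx _ (by omega)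
  have hsum : ∀ (a : Fin (n - 2 * g) → ℚ) (c : Fin (n - g + 1)),
      (∑ l, a l • G l) c =
        (p * ∑ l : Fin (n - 2 * g), Polynomial.monomial (l : ℕ) (a l)).coeff c := by
    intro a c
    rw [Finset.mul_sum, Polynomial.finsetSum_coeff, Finset.sum_apply]
    refine Finset.sum_congr rfl fun l _ => ?_
    have h1 : ((Polynomial.X ^ (l : ℕ) * P).coeff c : ℚ) = (Polynomial.X ^ (l : ℕ) * p).coeff c := by
      have : Polynomial.X ^ (l : ℕ) * p =
          (Polynomial.X ^ (l : ℕ) * P).map (Int.castRingHom ℚ) := by simp [hp]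
      rw [this, Polynomial.coeff_map]; simp
    simp only [Pi.smul_apply, G, smul_eq_mul, h1]
    rw [← Polynomial.C_mul_X_pow_eq_monomial, mul_left_comm, Polynomial.coeff_C_mul,
      mul_comm p]
  have hmdeg : ∀ a : Fin (n - 2 * g) → ℚ,
      (p * ∑ l : Fin (n - 2 * g), Polynomial.monomial (l : ℕ) (a l)).natDegree ≤ n - g := by
    intro a
    refine Polynomial.natDegree_mul_le.trans ?_
    have h1 : p.natDegree ≤ g + 1 := (Polynomial.natDegree_map_le).trans hP
    have h2 : (∑ l : Fin (n - 2 * g), Polynomial.monomial (l : ℕ) (a l)).natDegree ≤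
        n - 2 * g - 1 := by
      refine Polynomial.natDegree_sum_le_of_forall_le _ _ fun l _ => ?_
      have := l.is_lt
      exact (Polynomial.natDegree_monomial_le _).trans (by omega)
    omega
  have hGli : LinearIndependent ℚ G := by
    rw [Fintype.linearIndependent_iff]
    intro a ha
    have h1 : p * ∑ l : Fin (n - 2 * g), Polynomial.monomial (l : ℕ) (a l) = 0 := by
      ext c
      by_cases hc : c < n - g + 1
      · rw [← hsum a ⟨c, hc⟩, ha]; simp
      · rw [Polynomial.coeff_zero]
        exact Polynomial.coeff_eq_zero_of_natDegree_lt (by have := hmdeg a; omega)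
    have h2 := (mul_eq_zero.1 h1).resolve_left hp0
    intro l
    have h3 := congrArg (fun F : Polynomial ℚ => F.coeff l) h2
    simpa [Polynomial.finsetSum_coeff, Polynomial.coeff_monomial, Fin.val_inj] using h3
  have hspan : Submodule.span ℚ (Set.range G) = K := by
    apply Submodule.eq_of_le_of_finrank_eq
    · rw [Submodule.span_le]; rintro _ ⟨l, rfl⟩; exact hGK l
    · rw [finrank_span_eq_card hGli, Fintype.card_fin, hKdim]
  have hQK := hker Q hQ hQx
  rw [← hspan, Submodule.mem_span_range_iff_exists_fun] at hQK
  obtain ⟨a, ha⟩ := hQK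
  refine ⟨∑ l : Fin (n - 2 * g), Polynomial.monomial (l : ℕ) (a l), ?_⟩
  ext c
  by_cases hc : c < n - g + 1
  · rw [← hsum a ⟨c, hc⟩, ha]; simp
  · have hQ' := Polynomial.natDegree_map_le (f := Int.castRingHom ℚ) (p := Q)
    exact (Polynomial.coeff_eq_zero_of_natDegree_lt (by omega)).trans
      (Polynomial.coeff_eq_zero_of_natDegree_lt (by have := hmdeg a; omega)).symm

/-! ### Heights of minimal annihilators and transference -/

/-- The height of a primitive form of minimal degree annihilating a point close to the curve. The
exponent `n - 2 g` counts the multiples `X ^ l * P` that are orthogonal to the shifts of `x`. -/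
theorem supNorm_pow_le_of_annihilates (n : ℕ) (ξ : ℝ) (hξ : ξ ≠ 0) :
    ∃ C : ℝ, 1 ≤ C ∧ ∀ (g : ℕ) (x : ℕ → ℤ) (L : ℝ) (P : Polynomial ℤ), 2 * g + 1 ≤ n →
      IsClose n ξ x L → L ≤ 1 → x 0 ≠ 0 →
      (∀ F : Polynomial ℤ, F ≠ 0 → F.natDegree ≤ g → ¬ Annihilates n g x F) →
      P ≠ 0 → P.IsPrimitive → P.natDegree ≤ g + 1 → Annihilates n (g + 1) x P →
      P.supNorm ^ (n - 2 * g) ≤ C * (|(x 0 : ℝ)| * L ^ g) := by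
  obtain ⟨C, hC1, hC⟩ := exists_short_polynomial n ξ hξ
  have hK : (1 : ℝ) ≤ 2 ^ n * (n + 1) := by
    have h1 : (1 : ℝ) ≤ 2 ^ n := one_le_pow₀ (by norm_num)
    have h2 : (0 : ℝ) ≤ n := Nat.cast_nonneg n
    nlinarith
  refine ⟨(2 ^ n * (n + 1)) ^ n * C, one_le_mul_of_one_le_of_one_le (one_le_pow₀ hK) hC1, ?_⟩
  intro g x L P hgn hx hL1 hx0 hmin hP0 hPprim hPdeg hPx
  have hx1 : (1 : ℝ) ≤ |(x 0 : ℝ)| := by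
    rw [← Int.cast_abs]; exact_mod_cast Int.one_le_abs hx0
  obtain ⟨Q, hQ0, hQdeg, hQx, hQH⟩ := hC (Fin (g + 1)) (n - g) (fun v => v) (fun _ => x)
    (fun _ => L) |(x 0 : ℝ)| (L ^ g) (fun v => by have := v.is_lt; omega) (fun _ => hx)
    (fun _ => hL1) hx1 (fun _ => le_rfl)
    (fun l => by
      rw [Finset.prod_const, Finset.card_erase_of_mem (Finset.mem_univ _), Finset.card_univ,
        Fintype.card_fin, Nat.add_sub_cancel])
    (linearIndependent_shifts (by omega) x hmin) (by rw [Fintype.card_fin]; omega)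
  rw [Fintype.card_fin, show n - g + 1 - (g + 1) = n - 2 * g by omega] at hQH
  have hdvd : P ∣ Q := by
    have h1 := dvd_of_annihilates hgn hmin hP0 hPdeg hPx hQdeg
      (fun v hv => hQx ⟨v, Nat.lt_succ_of_le hv⟩)
    exact hPprim.dvd_of_fraction_map_dvd_fraction_map (K := ℚ) h1
  obtain ⟨S, rfl⟩ := hdvd
  have hS0 : S ≠ 0 := right_ne_zero_of_mul hQ0
  have h2 := supNorm_le_of_mul hP0 hS0 (N := n) (hQdeg.trans (Nat.sub_le _ _))
  calc P.supNorm ^ (n - 2 * g) ≤ (2 ^ n * (n + 1) * (P * S).supNorm) ^ (n - 2 * g) :=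
        pow_le_pow_left₀ P.supNorm_nonneg h2 _
    _ = (2 ^ n * (n + 1)) ^ (n - 2 * g) * (P * S).supNorm ^ (n - 2 * g) := mul_pow _ _ _
    _ ≤ (2 ^ n * (n + 1)) ^ n * (C * (|(x 0 : ℝ)| * L ^ g)) := by
        refine mul_le_mul (pow_le_pow_right₀ hK (Nat.sub_le _ _)) hQH
          (pow_nonneg (Polynomial.supNorm_nonneg _) _) (by positivity)
    _ = _ := by ring

/-- Khintchine's transference principle: when `w` exceeds the dual exponent in degree `k`, an
integer point within `L` of the line through `(1, ξ, …, ξ ^ k)` has height `≫ L ^ (-k / (w+1-k))`,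
because Siegel's lemma provides a short polynomial that annihilates it. -/
theorem exists_lower_bound_of_not_dualSolvable {k : ℕ} (hk : 1 ≤ k) {ξ : ℝ}
    (hξ : Transcendental ℚ ξ) {w : ℝ} (hw : (k : ℝ) < w + 1)
    (h : ∀ᶠ Q : ℝ in atTop, ¬ DualSolvable k ξ w Q) :
    ∃ c : ℝ, 0 < c ∧ ∀ (z : ℕ → ℤ) (L : ℝ), z 0 ≠ 0 → 0 < L → L ≤ 1 → IsClose k ξ z L →
      c * L ^ (-((k : ℝ) / (w + 1 - k))) ≤ |(z 0 : ℝ)| := by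
  have hξ0 : ξ ≠ 0 := by
    rintro rfl; exact hξ isAlgebraic_zero
  obtain ⟨C, hC1, hC⟩ := exists_short_polynomial k ξ hξ0
  obtain ⟨Q₀, hQ₀⟩ := eventually_atTop.1 h
  set B : ℝ := max C Q₀ with hB
  have hB1 : 1 ≤ B := hC1.trans (le_max_left _ _)
  have hk0 : (0 : ℝ) < k := by exact_mod_cast hk
  set D : ℝ := (k : ℝ) / (w + 1 - k) with hD
  have hD0 : 0 < D := div_pos hk0 (by linarith)
  set K : ℝ := (k + 1) * B ^ (1 + w) with hK
  have hK0 : 0 < K := by positivity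
  refine ⟨K ^ (-D), by positivity, ?_⟩
  intro z L hz hL0 hL1 hzL
  set Z : ℝ := |(z 0 : ℝ)| with hZ
  have hZ1 : 1 ≤ Z := by
    rw [hZ, ← Int.cast_abs]; exact_mod_cast Int.one_le_abs hz
  have hZ0 : 0 < Z := by linarith
  obtain ⟨P, hP0, hPdeg, hPz, hPH⟩ := hC Unit k (fun _ => 0) (fun _ => z) (fun _ => L) Z 1
    (fun _ => by omega) (fun _ => hzL) (fun _ => hL1) hZ1 (fun _ => le_rfl)
    (fun l => by
      have : (Finset.univ : Finset Unit).erase l = ∅ := by ext; simp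
      rw [this]; simp)
    (by
      rw [linearIndependent_unique_iff]
      intro h0
      have := congrFun h0 0
      simp [shift] at this
      exact hz this)
    (by simp; omega)
  rw [Fintype.card_unit, Nat.add_sub_cancel, mul_one] at hPH
  set T : ℝ := B * Z ^ (1 / (k : ℝ)) with hT
  have hZk1 : 1 ≤ Z ^ (1 / (k : ℝ)) := Real.one_le_rpow hZ1 (by positivity)
  have hTB : B ≤ T := le_mul_of_one_le_right (by linarith) hZk1
  have hT0 : 0 < T := by linarith
  have hHT : P.supNorm ≤ T := by
    refine le_of_pow_le_pow_left₀ (by omega : k ≠ 0) hT0.le (hPH.trans ?_)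
    have h1 : (Z ^ (1 / (k : ℝ))) ^ k = Z := by
      rw [← Real.rpow_natCast, ← Real.rpow_mul hZ0.le, one_div_mul_cancel hk0.ne', Real.rpow_one]
    rw [hT, mul_pow, h1]
    have : C ≤ B ^ k := (le_max_left _ _).trans (le_self_pow₀ hB1 (by omega))
    gcongr
  have hev0 : 0 < |Polynomial.aeval ξ P| := abs_pos.2 (aeval_ne_zero_of_transcendental hξ hP0)
  have hlow : T ^ (-w) < |Polynomial.aeval ξ P| := by
    by_contra hcon
    push Not at hcon
    exact hQ₀ T ((le_max_right _ _).trans hTB) ⟨P, hev0, hcon, hPdeg, hHT⟩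
  have hup : Z * |Polynomial.aeval ξ P| ≤ (k + 1) * P.supNorm * L := by
    have h1 := abs_momentPairing_sub_le hzL P hPdeg (v := 0) (by omega)
    rw [hPz ()] at h1
    simpa [abs_mul, hZ] using h1
  have h1 : Z < K * Z ^ ((1 + w) / k) * L := by
    have h2 : Z * T ^ (-w) < (k + 1) * T * L :=
      calc Z * T ^ (-w) < Z * |Polynomial.aeval ξ P| := by gcongr
        _ ≤ (k + 1) * P.supNorm * L := hup
        _ ≤ (k + 1) * T * L := by gcongr
    have h3 : Z = Z * T ^ (-w) * T ^ w := by
      rw [mul_assoc, ← Real.rpow_add hT0]; simp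
    have h4 : T ^ (1 + w) = B ^ (1 + w) * Z ^ ((1 + w) / k) := by
      rw [hT, Real.mul_rpow (by linarith) (by positivity), ← Real.rpow_mul hZ0.le]
      congr 2; ring
    calc Z = Z * T ^ (-w) * T ^ w := h3
      _ < (k + 1) * T * L * T ^ w := by gcongr
      _ = (k + 1) * (T ^ (1 + w)) * L := by rw [Real.rpow_add hT0, Real.rpow_one]; ring
      _ = _ := by rw [h4, hK]; ring
  have h5 : L⁻¹ ≤ K * Z ^ (1 / D) := by
    have h6 : Z ^ ((1 + w) / k) = Z ^ (1 / D) * Z := by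
      conv_rhs => rw [← Real.rpow_one Z, ← Real.rpow_mul hZ0.le, ← Real.rpow_add hZ0]
      congr 1
      rw [hD, one_div_div]; field_simp; ring
    rw [h6] at h1
    rw [inv_le_iff_one_le_mul₀ hL0]
    have : 1 * Z < (K * Z ^ (1 / D) * L) * Z := by
      calc 1 * Z = Z := one_mul _
        _ < _ := h1
        _ = _ := by ring
    exact (lt_of_mul_lt_mul_right this hZ0.le).le
  have h7 := Real.rpow_le_rpow (inv_nonneg.2 hL0.le) h5 hD0.le
  rw [Real.mul_rpow hK0.le (by positivity), ← Real.rpow_mul hZ0.le, one_div_mul_cancel hD0.ne',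
    Real.rpow_one, Real.inv_rpow hL0.le, ← Real.rpow_neg hL0.le] at h7
  calc K ^ (-D) * L ^ (-D) ≤ K ^ (-D) * (K ^ D * Z) := by gcongr
    _ = Z := by rw [← mul_assoc, ← Real.rpow_add hK0]; simp

/-! ### Approximation sequences -/

/-- A sequence of integer points `x i`, with nondecreasing `|x i 0|`, within `L i` of the line
through `(1, ξ, …, ξ ^ n)`, such that `|x (i + 1) 0| ≪ L i ^ (η - w)`. For some `η > 0` such a
sequence exists as soon as the uniform exponent exceeds `1 / w`. -/
structure IsApproximationSequence (n : ℕ) (ξ w η : ℝ) (x : ℕ → ℕ → ℤ) (L : ℕ → ℝ) : Prop where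
  ne_zero : ∀ i, x i 0 ≠ 0
  close : ∀ i, IsClose n ξ (x i) (L i)
  mono : ∀ i, |(x i 0 : ℝ)| ≤ |(x (i + 1) 0 : ℝ)|
  pos : ∀ i, 0 < L i
  le_one : ∀ i, L i ≤ 1
  anti : Antitone L
  tendsto : Tendsto L atTop (nhds 0)
  gap : ∀ i, |(x (i + 1) 0 : ℝ)| * L i ^ w ≤ 2 * L i ^ η

theorem IsApproximationSequence.one_le {n : ℕ} {ξ w η : ℝ} {x : ℕ → ℕ → ℤ} {L : ℕ → ℝ}
    (h : IsApproximationSequence n ξ w η x L) (i : ℕ) : 1 ≤ |(x i 0 : ℝ)| := by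
  rw [← Int.cast_abs]; exact_mod_cast Int.one_le_abs (h.ne_zero i)

theorem IsApproximationSequence.tendsto_mul_rpow {n : ℕ} {ξ w η : ℝ} {x : ℕ → ℕ → ℤ} {L : ℕ → ℝ}
    (h : IsApproximationSequence n ξ w η x L) (hη : 0 < η) (A : ℝ) :
    Tendsto (fun i => A * L i ^ η) atTop (nhds 0) := by
  have h1 := h.tendsto.rpow_const (p := η) (Or.inr hη.le)
  rw [Real.zero_rpow hη.ne'] at h1
  simpa using h1.const_mul A

theorem finite_natDegree_le_supNorm_le (d : ℕ) (B : ℝ) :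
    {P : Polynomial ℤ | P.natDegree ≤ d ∧ P.supNorm ≤ B}.Finite := by
  have hfin : (Set.pi Set.univ fun _ : Fin (d + 1) => Set.Icc (-⌈B⌉) ⌈B⌉).Finite :=
    Set.Finite.pi fun _ => Set.finite_Icc _ _
  refine (hfin.image fun a => ∑ v : Fin (d + 1), Polynomial.monomial (v : ℕ) (a v)).subset ?_
  rintro P ⟨hd, hB⟩
  refine ⟨fun v => P.coeff v, ?_, ?_⟩
  · intro v _
    have h1 := (abs_coeff_le_supNorm P v).trans (hB.trans (Int.le_ceil B))
    have h2 : |P.coeff v| ≤ ⌈B⌉ := by exact_mod_cast h1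
    exact Set.mem_Icc.2 (abs_le.1 h2)
  · have := Polynomial.as_sum_range' P (d + 1) (Nat.lt_succ_of_le hd)
    rw [Finset.sum_range] at this
    exact this.symm

theorem abs_pow_le_one_add_abs_pow (ξ : ℝ) {v n : ℕ} (hv : v ≤ n) : |ξ| ^ v ≤ (1 + |ξ|) ^ n := by
  have := abs_nonneg ξ
  exact (pow_le_pow_left₀ this (by linarith) v).trans (pow_le_pow_right₀ (by linarith) hv)

/-- If a polynomial annihilates a point but not the preceding one, its height is `≫ 1 / L`. -/
theorem IsApproximationSequence.one_le_of_annihilates_succ {n d : ℕ} {ξ w η : ℝ}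
    {x : ℕ → ℕ → ℤ} {L : ℕ → ℝ} (h : IsApproximationSequence n ξ w η x L) (hd : d ≤ n)
    {P : Polynomial ℤ} (hP : P.natDegree ≤ d) {i : ℕ} (h1 : Annihilates n d (x (i + 1)) P)
    (h2 : ¬ Annihilates n d (x i) P) :
    1 ≤ ((1 + |ξ|) ^ n + 1) * (n + 1) * P.supNorm * L i := by
  unfold Annihilates at h2
  push Not at h2
  obtain ⟨v, hv, hne⟩ := h2
  set R := (1 + |ξ|) ^ n
  have h3 : (1 : ℝ) ≤ |(momentPairing (shift v (x i)) P : ℝ)| := by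
    rw [← Int.cast_abs]; exact_mod_cast Int.one_le_abs hne
  have h4 := abs_momentPairing_sub_le (h.close i) P hP hv
  have h5 : |(x i 0 : ℝ) * ξ ^ v * Polynomial.aeval ξ P| ≤ R * ((n + 1) * P.supNorm * L i) := by
    have h6 := h1.abs_aeval_le (h.close (i + 1)) hP hd
    have h7 : (n + 1) * P.supNorm * L (i + 1) ≤ (n + 1) * P.supNorm * L i := by
      have := P.supNorm_nonneg
      have := h.anti (Nat.le_succ i)
      gcongr
    have h8 : |(x i 0 : ℝ)| * |Polynomial.aeval ξ P| ≤
        |(x (i + 1) 0 : ℝ)| * |Polynomial.aeval ξ P| :=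
      mul_le_mul_of_nonneg_right (h.mono i) (abs_nonneg _)
    calc |(x i 0 : ℝ) * ξ ^ v * Polynomial.aeval ξ P|
        = |ξ| ^ v * (|(x i 0 : ℝ)| * |Polynomial.aeval ξ P|) := by
          rw [abs_mul, abs_mul, abs_pow]; ring
      _ ≤ R * ((n + 1) * P.supNorm * L i) := by
          refine mul_le_mul (abs_pow_le_one_add_abs_pow ξ (by omega)) (by linarith)
            (by positivity) (by positivity)
  have h9 := abs_sub_abs_le_abs_sub (momentPairing (shift v (x i)) P : ℝ)
    (x i 0 * ξ ^ v * Polynomial.aeval ξ P)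
  nlinarith

/-- The points of an approximation sequence satisfy no recurrence of order at most `m`, from some
index on. By induction on the order: a relation of minimal order holding at one point propagates to
all earlier ones, so that its height is bounded, and `P(ξ)` would get arbitrarily small among
finitely many polynomials. -/
theorem IsApproximationSequence.eventually_not_annihilates {n m : ℕ} {ξ w η : ℝ}
    {x : ℕ → ℕ → ℤ} {L : ℕ → ℝ} (h : IsApproximationSequence n ξ w η x L)
    (hξ : Transcendental ℚ ξ) (hη : 0 < η) (hmn : 2 * m + 1 ≤ n) (hw : w ≤ n - m) :
    ∀ g, g ≤ m → ∀ᶠ i in atTop, ∀ P : Polynomial ℤ, P ≠ 0 → P.natDegree ≤ g →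
      ¬ Annihilates n g (x i) P := by
  have hξ0 : ξ ≠ 0 := by
    rintro rfl; exact hξ isAlgebraic_zero
  obtain ⟨C, hC1, hC⟩ := supNorm_pow_le_of_annihilates n ξ hξ0
  intro g
  induction g with
  | zero =>
    intro _
    refine Eventually.of_forall fun i P hP0 hP hPx => ?_
    have h1 := hPx 0 (Nat.zero_le _)
    rw [momentPairing_eq_sum _ _ hP] at h1
    simp only [zero_add, Finset.sum_range_one, shift, mul_eq_zero, h.ne_zero i, or_false] at h1
    apply hP0
    rw [Polynomial.eq_C_of_natDegree_le_zero hP, h1, Polynomial.C_0]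
  | succ g ih =>
    intro hgm
    obtain ⟨i₁, hi₁⟩ := eventually_atTop.1 (ih (by omega))
    set A : ℝ := ((1 + |ξ|) ^ n + 1) * (n + 1) with hA
    have hA1 : 1 ≤ A := by
      have h1 : (1 : ℝ) ≤ (1 + |ξ|) ^ n := one_le_pow₀ (by have := abs_nonneg ξ; linarith)
      have h2 : (0 : ℝ) ≤ n := Nat.cast_nonneg n
      rw [hA]; nlinarith
    obtain ⟨i₂, hi₂⟩ := eventually_atTop.1
      ((h.tendsto_mul_rpow hη (2 * C * A ^ n)).eventually_lt_const one_pos)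
    set i₀ := max i₁ i₂
    -- a relation of order `g + 1` propagates backwards
    have hback : ∀ i, i₀ ≤ i → ∀ P : Polynomial ℤ, P ≠ 0 → P.IsPrimitive →
        P.natDegree ≤ g + 1 → Annihilates n (g + 1) (x (i + 1)) P →
        Annihilates n (g + 1) (x i) P := by
      intro i hi P hP0 hPp hPd hPx
      by_contra hcon
      have hle := h.anti (Nat.le_succ i)
      have h1 := h.one_le_of_annihilates_succ (by omega) hPd hPx hcon
      rw [← hA] at h1
      have h2 := hC g (x (i + 1)) (L (i + 1)) P (by omega) (h.close _) (h.le_one _) (h.ne_zero _)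
        (hi₁ _ (by omega)) hP0 hPp hPd hPx
      have hL0 := h.pos i
      have hL1 := h.le_one i
      have hX0 := abs_nonneg (x (i + 1) 0 : ℝ)
      have h3 : 1 ≤ (A * P.supNorm * L i) ^ (n - 2 * g) := one_le_pow₀ h1
      have h4 : L i ^ (n - 2 * g) * L i ^ g ≤ L i ^ w := by
        rw [← pow_add, ← Real.rpow_natCast]
        refine Real.rpow_le_rpow_of_exponent_ge hL0 hL1 ?_
        have : m ≤ n := by omega
        have h5 : ((n - 2 * g + g : ℕ) : ℝ) = n - g := by
          rw [show n - 2 * g + g = n - g by omega, Nat.cast_sub (by omega)]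
        have h6 : (g : ℝ) ≤ m := by exact_mod_cast (by omega : g ≤ m)
        rw [h5]; linarith
      have h7 : (A * P.supNorm * L i) ^ (n - 2 * g) ≤ 2 * C * A ^ n * L i ^ η :=
        calc (A * P.supNorm * L i) ^ (n - 2 * g)
            = A ^ (n - 2 * g) * P.supNorm ^ (n - 2 * g) * L i ^ (n - 2 * g) := by
              rw [mul_pow, mul_pow]
          _ ≤ A ^ n * (C * (|(x (i + 1) 0 : ℝ)| * L (i + 1) ^ g)) * L i ^ (n - 2 * g) := by
              refine mul_le_mul_of_nonneg_right ?_ (by positivity)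
              exact mul_le_mul (pow_le_pow_right₀ hA1 (Nat.sub_le _ _)) h2
                (pow_nonneg P.supNorm_nonneg _) (by positivity)
          _ ≤ A ^ n * (C * (|(x (i + 1) 0 : ℝ)| * L i ^ g)) * L i ^ (n - 2 * g) := by
              have := (h.pos (i + 1)).le
              gcongr
          _ = A ^ n * C * |(x (i + 1) 0 : ℝ)| * (L i ^ (n - 2 * g) * L i ^ g) := by ring
          _ ≤ A ^ n * C * |(x (i + 1) 0 : ℝ)| * L i ^ w := by gcongr
          _ = A ^ n * C * (|(x (i + 1) 0 : ℝ)| * L i ^ w) := by ring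
          _ ≤ A ^ n * C * (2 * L i ^ η) :=
              mul_le_mul_of_nonneg_left (h.gap i) (by positivity)
          _ = _ := by ring
      have h8 := hi₂ i (by omega)
      linarith
    have hback' : ∀ (r : ℕ) (P : Polynomial ℤ), P ≠ 0 → P.IsPrimitive → P.natDegree ≤ g + 1 →
        Annihilates n (g + 1) (x (i₀ + r)) P → Annihilates n (g + 1) (x i₀) P := by
      intro r
      induction r with
      | zero => intro P _ _ _ hx; exact hx
      | succ r ihr =>
        intro P h0 hp hd hx
        exact ihr P h0 hp hd (hback (i₀ + r) (by omega) P h0 hp hd hx)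
    set B : ℝ := C * (|(x i₀ 0 : ℝ)| * L i₀ ^ g) with hB
    have hfin := (finite_natDegree_le_supNorm_le n B).inter_of_left {P | P ≠ 0}
    have hsmall : ∀ᶠ j in atTop, ∀ P ∈ {P : Polynomial ℤ | P.natDegree ≤ n ∧ P.supNorm ≤ B} ∩
        {P | P ≠ 0}, (n + 1) * B * L j < |Polynomial.aeval ξ P| := by
      rw [eventually_all_finite hfin]
      rintro P ⟨-, hP⟩
      have h1 : Tendsto (fun j => (n + 1) * B * L j) atTop (nhds 0) := by
        simpa using h.tendsto.const_mul ((n + 1) * B)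
      exact h1.eventually_lt_const (abs_pos.2 (aeval_ne_zero_of_transcendental hξ hP))
    filter_upwards [hsmall, eventually_ge_atTop i₀] with j hj hji P hP0 hPd hPx
    set F := P.primPart with hF
    have hF0 : F ≠ 0 := P.isPrimitive_primPart.ne_zero
    have hFp : F.IsPrimitive := P.isPrimitive_primPart
    have hFd : F.natDegree ≤ g + 1 := by rw [hF, Polynomial.natDegree_primPart]; exact hPd
    have hFx : Annihilates n (g + 1) (x j) F := hPx.primPart hP0
    have hFx₀ : Annihilates n (g + 1) (x i₀) F := by
      refine hback' (j - i₀) F hF0 hFp hFd ?_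
      rwa [Nat.add_sub_cancel' hji]
    have h1 := hC g (x i₀) (L i₀) F (by omega) (h.close _) (h.le_one _) (h.ne_zero _)
      (hi₁ _ (le_max_left _ _)) hF0 hFp hFd hFx₀
    have hFB : F.supNorm ≤ B := by
      refine le_trans ?_ h1
      exact le_self_pow₀ (one_le_supNorm hF0) (by omega)
    have h2 := hj F ⟨⟨by omega, hFB⟩, hF0⟩
    have h3 := hFx.abs_aeval_le (h.close j) hFd (by omega)
    have h4 : |Polynomial.aeval ξ F| ≤ |(x j 0 : ℝ)| * |Polynomial.aeval ξ F| :=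
      le_mul_of_one_le_left (abs_nonneg _) (h.one_le j)
    have h5 : (n + 1) * F.supNorm * L j ≤ (n + 1) * B * L j := by
      have := (h.pos j).le
      gcongr
    linarith

/-! ### Common annihilators of two points -/

theorem card_lt_of_orthogonal {κ ι : Type*} [Fintype κ] [Fintype ι]
    (u : Matrix κ ι ℚ) (hu : LinearIndependent ℚ u.row) (q : ι → ℚ) (hq : q ≠ 0)
    (hqu : u.mulVec q = 0) : Fintype.card κ < Fintype.card ι := by
  classical
  have h1 : Module.finrank ℚ (LinearMap.range u.mulVecLin) +
      Module.finrank ℚ (LinearMap.ker u.mulVecLin) = Module.finrank ℚ (ι → ℚ) :=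
    LinearMap.finrank_range_add_finrank_ker u.mulVecLin
  have h2 : Module.finrank ℚ (LinearMap.range u.mulVecLin) = Fintype.card κ :=
    LinearIndependent.rank_matrix hu
  rw [h2, Module.finrank_fintype_fun_eq_card] at h1
  have h3 : 0 < Module.finrank ℚ (LinearMap.ker u.mulVecLin) := by
    rw [Module.finrank_pos_iff]
    refine ⟨⟨⟨q, hqu⟩, 0, fun h => hq ?_⟩⟩
    exact congrArg Subtype.val h
  omega

/-- Pairing with `Q`, as a rational functional on truncated sequences. -/
theorem momentPairing_cast_eq (x : ℕ → ℤ) {Q : Polynomial ℤ} {d : ℕ} (hQ : Q.natDegree ≤ d) :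
    (momentPairing x Q : ℚ) = (fun c : Fin (d + 1) => (x c : ℚ)) ⬝ᵥ
      fun c : Fin (d + 1) => (Q.coeff c : ℚ) := by
  rw [momentPairing_eq_sum _ _ hQ, Finset.sum_range fun c => Q.coeff c * x c]
  push_cast
  exact Finset.sum_congr rfl fun c _ => mul_comm _ _

/-- If two points have a common annihilator of degree at most `n - m`, and the first one (the
closer to the curve) has independent shifts, they have a short one: the dimension of the span of
all shifts is `m + 1 + s`, the shifts of the first point providing `m + 1` of the basis vectors. -/
theorem exists_short_common_annihilator (n : ℕ) (ξ : ℝ) (hξ : ξ ≠ 0) :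
    ∃ C : ℝ, 1 ≤ C ∧ ∀ (m t : ℕ), n = 2 * m + 1 + t → ∀ (y y' : ℕ → ℤ) (L L' X : ℝ),
      IsClose n ξ y L → IsClose n ξ y' L' → 0 < L → L ≤ L' → L' ≤ 1 → 1 ≤ X →
      |(y 0 : ℝ)| ≤ X → |(y' 0 : ℝ)| ≤ X →
      (∀ P : Polynomial ℤ, P ≠ 0 → P.natDegree ≤ m → ¬ Annihilates n m y P) →
      ∀ Q : Polynomial ℤ, Q ≠ 0 → Q.natDegree ≤ n - m → Annihilates n (n - m) y Q →
      Annihilates n (n - m) y' Q →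
      ∃ s ≤ t, ∃ Q' : Polynomial ℤ, Q' ≠ 0 ∧ Q'.natDegree ≤ n - m ∧
        Annihilates n (n - m) y' Q' ∧ Q'.supNorm ^ (t + 1 - s) ≤ C * (X * (L ^ m * L' ^ s)) := by
  classical
  obtain ⟨C, hC1, hC⟩ := exists_short_polynomial n ξ hξ
  refine ⟨C, hC1, ?_⟩
  intro m t hn y y' L L' X hy hy' hL0 hLL' hL'1 hX1 hyX hyX' hmin Q hQ0 hQd hQy hQy'
  have hL'0 : 0 < L' := hL0.trans_le hLL'
  let V : Fin (m + 1) ⊕ Fin (m + 1) → Fin (n - m + 1) → ℚ :=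
    Sum.elim (fun v c => (shift v y c : ℚ)) (fun v c => (shift v y' c : ℚ))
  have hli : LinearIndepOn ℚ V (Set.range Sum.inl) := by
    rw [linearIndepOn_range_iff Sum.inl_injective]
    exact linearIndependent_shifts (by omega) y hmin
  set b := hli.extend (Set.subset_univ _) with hb
  have hbli : LinearIndepOn ℚ V b := hli.linearIndepOn_extend _
  have hbspan : Submodule.span ℚ (V '' b) = Submodule.span ℚ (V '' Set.univ) :=
    hli.span_image_extend_eq_span_image _
  have hbl : Set.range Sum.inl ⊆ b := hli.subset_extend _
  set σ : Finset (Fin (m + 1)) := Finset.univ.filter fun v => Sum.inr v ∈ b with hσ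
  let a : Fin (m + 1) ⊕ σ → b := Sum.elim (fun v => ⟨Sum.inl v, hbl ⟨v, rfl⟩⟩)
    (fun v => ⟨Sum.inr v, (Finset.mem_filter.1 v.2).2⟩)
  have hainj : Function.Injective a := by
    rintro (v | v) (v' | v') hvv <;> simp [a] at hvv ⊢
    · exact hvv
    · exact hvv
  have hasurj : ∀ p ∈ b, ∃ l, (a l : Fin (m + 1) ⊕ Fin (m + 1)) = p := by
    rintro (v | v) hp
    · exact ⟨Sum.inl v, rfl⟩
    · exact ⟨Sum.inr ⟨v, Finset.mem_filter.2 ⟨Finset.mem_univ _, hp⟩⟩, rfl⟩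
  let vv : Fin (m + 1) ⊕ σ → ℕ := Sum.elim (fun v => (v : ℕ)) (fun v => ((v : Fin (m + 1)) : ℕ))
  let yy : Fin (m + 1) ⊕ σ → ℕ → ℤ := Sum.elim (fun _ => y) (fun _ => y')
  let ε : Fin (m + 1) ⊕ σ → ℝ := Sum.elim (fun _ => L) (fun _ => L')
  have hrow : ∀ l, (fun c : Fin (n - m + 1) => (shift (vv l) (yy l) c : ℚ)) =
      V (a l : Fin (m + 1) ⊕ Fin (m + 1)) := by
    rintro (v | v) <;> rfl
  have hvv : ∀ l, vv l + (n - m) ≤ n := by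
    rintro (v | v)
    · have := v.is_lt
      simp only [vv, Sum.elim_inl]; omega
    · have := v.1.is_lt
      simp only [vv, Sum.elim_inr]; omega
  have hκli : LinearIndependent ℚ fun l (c : Fin (n - m + 1)) => (shift (vv l) (yy l) c : ℚ) := by
    have := LinearIndependent.comp hbli a hainj
    exact (funext hrow : _ = fun l => V (a l : Fin (m + 1) ⊕ Fin (m + 1))) ▸ this
  have hQl : ∀ l, momentPairing (shift (vv l) (yy l)) Q = 0 := by
    rintro (v | v)
    · exact hQy _ (hvv (Sum.inl v))
    · exact hQy' _ (hvv (Sum.inr v))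
  set s := σ.card with hs
  have hcardκ : Fintype.card (Fin (m + 1) ⊕ σ) = m + 1 + s := by simp [hs]
  have hcard : Fintype.card (Fin (m + 1) ⊕ σ) < n - m + 1 := by
    have := card_lt_of_orthogonal
      (fun l (c : Fin (n - m + 1)) => (shift (vv l) (yy l) c : ℚ)) hκli
      (fun c => (Q.coeff c : ℚ)) (by
        intro h0
        apply hQ0
        ext c
        by_cases hc : c < n - m + 1
        · have := congrFun h0 ⟨c, hc⟩
          simpa using this
        · rw [Polynomial.coeff_zero]
          exact Polynomial.coeff_eq_zero_of_natDegree_lt (by omega))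
      (by
        funext l
        have := momentPairing_cast_eq (shift (vv l) (yy l)) hQd
        rw [hQl l, Int.cast_zero] at this
        exact this.symm)
    simpa using this
  have hst : s ≤ t := by omega
  have hε0 : ∀ l, L ≤ ε l := by
    rintro (v | v)
    · exact le_rfl
    · exact hLL'
  have hprod : ∏ l, ε l = L ^ (m + 1) * L' ^ s := by
    simp [ε, Fintype.prod_sum_type, hs]
  obtain ⟨Q', hQ'0, hQ'd, hQ'x, hQ'H⟩ := hC (Fin (m + 1) ⊕ σ) (n - m) vv yy ε X
    (L ^ m * L' ^ s) hvv
    (by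
      rintro (v | v)
      · exact hy
      · exact hy')
    (by
      rintro (v | v)
      · exact hLL'.trans hL'1
      · exact hL'1)
    hX1
    (by
      rintro (v | v)
      · exact hyX
      · exact hyX')
    (by
      intro l
      have h1 := Finset.mul_prod_erase Finset.univ ε (Finset.mem_univ l)
      rw [hprod] at h1
      have h2 : 0 ≤ ∏ l' ∈ Finset.univ.erase l, ε l' :=
        Finset.prod_nonneg fun l' _ => hL0.le.trans (hε0 l')
      have h3 : L * ∏ l' ∈ Finset.univ.erase l, ε l' ≤ L * (L ^ m * L' ^ s) := by
        calc L * ∏ l' ∈ Finset.univ.erase l, ε l' ≤ ε l * ∏ l' ∈ Finset.univ.erase l, ε l' :=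
              mul_le_mul_of_nonneg_right (hε0 l) h2
          _ = L * (L ^ m * L' ^ s) := by rw [h1]; ring
      exact le_of_mul_le_mul_left h3 hL0)
    hκli hcard
  refine ⟨s, hst, Q', hQ'0, hQ'd, ?_, ?_⟩
  · intro v hv
    have hv' : v < m + 1 := by omega
    -- the functional vanishes on the basis, hence on every shift
    have hmem : V (Sum.inr ⟨v, hv'⟩) ∈ Submodule.span ℚ (V '' b) := by
      rw [hbspan]
      exact Submodule.subset_span ⟨_, Set.mem_univ _, rfl⟩
    let ψ : (Fin (n - m + 1) → ℚ) →ₗ[ℚ] ℚ :=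
      (dotProductBilin ℚ ℚ).flip fun c : Fin (n - m + 1) => (Q'.coeff c : ℚ)
    have hψ : Submodule.span ℚ (V '' b) ≤ LinearMap.ker ψ := by
      rw [Submodule.span_le]
      rintro _ ⟨p, hp, rfl⟩
      obtain ⟨l, rfl⟩ := hasurj p hp
      have := momentPairing_cast_eq (shift (vv l) (yy l)) hQ'd
      rw [hQ'x l, Int.cast_zero, hrow] at this
      exact this.symm
    have h1 := hψ hmem
    have h2 := momentPairing_cast_eq (shift v y') hQ'd
    have h3 : ((momentPairing (shift v y') Q' : ℤ) : ℚ) = 0 := by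
      rw [h2]; exact h1
    exact_mod_cast h3
  · rw [hcardκ, show n - m + 1 - (m + 1 + s) = t + 1 - s by omega] at hQ'H
    exact hQ'H

theorem exists_nat_eq_supNorm (P : Polynomial ℤ) : ∃ h : ℕ, P.supNorm = h := by
  obtain ⟨i, hi⟩ := P.exists_eq_supNorm
  exact ⟨(P.coeff i).natAbs, by rw [hi, Int.norm_eq_abs, Nat.cast_natAbs, Int.cast_abs]⟩

/-- A nonempty set of integer polynomials has an element of least height. -/
theorem exists_minimal_supNorm (p : Polynomial ℤ → Prop) (hp : ∃ P, p P) :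
    ∃ P, p P ∧ ∀ P', p P' → P.supNorm ≤ P'.supNorm := by
  classical
  have hex : ∃ h : ℕ, ∃ P, p P ∧ P.supNorm = h := by
    obtain ⟨P, hP⟩ := hp
    obtain ⟨h, hh⟩ := exists_nat_eq_supNorm P
    exact ⟨h, P, hP, hh⟩
  obtain ⟨P, hP, hPh⟩ := Nat.find_spec hex
  refine ⟨P, hP, fun P' hP' => ?_⟩
  obtain ⟨h', hh'⟩ := exists_nat_eq_supNorm P'
  rw [hPh, hh']
  exact_mod_cast Nat.find_min' hex ⟨P', hP', hh'⟩

/-! ### Exponents of approximation sequences -/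

/-- If no form of degree `m` annihilates a point, a short form of degree `n - m` does: the `m + 1`
shifts to which it has to be orthogonal are linearly independent. -/
theorem exists_short_annihilator (n : ℕ) (ξ : ℝ) (hξ : ξ ≠ 0) :
    ∃ C : ℝ, 1 ≤ C ∧ ∀ (m t : ℕ), n = 2 * m + 1 + t → ∀ (y : ℕ → ℤ) (L : ℝ),
      IsClose n ξ y L → L ≤ 1 → y 0 ≠ 0 →
      (∀ P : Polynomial ℤ, P ≠ 0 → P.natDegree ≤ m → ¬ Annihilates n m y P) →
      ∃ Q : Polynomial ℤ, Q ≠ 0 ∧ Q.natDegree ≤ n - m ∧ Annihilates n (n - m) y Q ∧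
        Q.supNorm ^ (t + 1) ≤ C * (|(y 0 : ℝ)| * L ^ m) := by
  obtain ⟨C, hC1, hC⟩ := exists_short_polynomial n ξ hξ
  refine ⟨C, hC1, ?_⟩
  intro m t hn y L hy hL1 hy0 hmin
  obtain ⟨Q, hQ0, hQd, hQy, hQH⟩ := hC (Fin (m + 1)) (n - m) (fun v => v) (fun _ => y)
    (fun _ => L) |(y 0 : ℝ)| (L ^ m) (fun v => by have := v.is_lt; omega) (fun _ => hy)
    (fun _ => hL1) (by rw [← Int.cast_abs]; exact_mod_cast Int.one_le_abs hy0) (fun _ => le_rfl)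
    (fun l => by
      rw [Finset.prod_const, Finset.card_erase_of_mem (Finset.mem_univ _), Finset.card_univ,
        Fintype.card_fin, Nat.add_sub_cancel])
    (linearIndependent_shifts (by omega) y hmin) (by rw [Fintype.card_fin]; omega)
  rw [Fintype.card_fin, show n - m + 1 - (m + 1) = t + 1 by omega] at hQH
  exact ⟨Q, hQ0, hQd, fun v hv => hQy ⟨v, by omega⟩, hQH⟩

/-- A form `Q` of degree `n - m` maps a point near the line through `(1, ξ, …, ξ ^ n)` to an integer
point near the line through `(1, ξ, …, ξ ^ m)`. Unless the image is zero, or the error is not small,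
its first coordinate is nonzero and `≪ |x 0 * Q(ξ)|`. -/
theorem isClose_momentPairing {n m : ℕ} {ξ : ℝ} {x : ℕ → ℤ} {L : ℝ} (hx : IsClose n ξ x L)
    (hmn : m ≤ n) {Q : Polynomial ℤ} (hQ : Q.natDegree ≤ n - m)
    (hne : ¬ Annihilates n (n - m) x Q)
    (hsmall : ((1 + |ξ|) ^ n + 1) * (n + 1) * (Q.supNorm * L) ≤ 1 / 2) :
    let z : ℕ → ℤ := fun v => momentPairing (shift v x) Q
    z 0 ≠ 0 ∧ IsClose m ξ z (((1 + |ξ|) ^ n + 1) * (n + 1) * (Q.supNorm * L)) ∧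
      |(z 0 : ℝ)| ≤ 2 * (|(x 0 : ℝ)| * |Polynomial.aeval ξ Q|) := by
  intro z
  have hL : 0 ≤ L := (abs_nonneg _).trans (hx 0 (Nat.zero_le _))
  have hHL : 0 ≤ Q.supNorm * L := mul_nonneg Q.supNorm_nonneg hL
  have hn0 : (0 : ℝ) ≤ n := Nat.cast_nonneg n
  set R : ℝ := (1 + |ξ|) ^ n with hR
  have hR1 : 1 ≤ R := one_le_pow₀ (by have := abs_nonneg ξ; linarith)
  set e : ℝ := (n + 1) * (Q.supNorm * L) with he
  have he0 : 0 ≤ e := by positivity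
  have hpair : ∀ v, v ≤ m →
      |(z v : ℝ) - x 0 * ξ ^ v * Polynomial.aeval ξ Q| ≤ e := by
    intro v hv
    have := abs_momentPairing_sub_le hx Q hQ (v := v) (by omega)
    rw [mul_assoc ((n : ℝ) + 1)] at this
    exact this
  have hclose : IsClose m ξ z ((R + 1) * (n + 1) * (Q.supNorm * L)) := by
    intro v hv
    have h1 := hpair v hv
    have h2 := hpair 0 (Nat.zero_le _)
    rw [pow_zero, mul_one] at h2
    have h3 : (z 0 : ℝ) * ξ ^ v - z v =
        ξ ^ v * (z 0 - x 0 * Polynomial.aeval ξ Q) -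
          (z v - x 0 * ξ ^ v * Polynomial.aeval ξ Q) := by ring
    rw [h3]
    refine (abs_sub _ _).trans ?_
    rw [abs_mul, abs_pow]
    have h4 : |ξ| ^ v * |(z 0 : ℝ) - x 0 * Polynomial.aeval ξ Q| ≤ R * e :=
      mul_le_mul (abs_pow_le_one_add_abs_pow ξ (by omega)) h2 (abs_nonneg _) (by linarith)
    calc _ ≤ R * e + e := add_le_add h4 h1
      _ = _ := by rw [he]; ring
  have hz0 : z 0 ≠ 0 := by
    intro h0
    unfold Annihilates at hne
    push Not at hne
    obtain ⟨v, hv, hzv⟩ := hne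
    have h1 : (1 : ℝ) ≤ |(z v : ℝ)| := by
      rw [← Int.cast_abs]; exact_mod_cast Int.one_le_abs hzv
    have h2 := hclose v (by omega)
    rw [h0, Int.cast_zero, zero_mul, zero_sub, abs_neg] at h2
    linarith
  refine ⟨hz0, hclose, ?_⟩
  have h1 : (1 : ℝ) ≤ |(z 0 : ℝ)| := by
    rw [← Int.cast_abs]; exact_mod_cast Int.one_le_abs hz0
  have h2 := hpair 0 (Nat.zero_le _)
  rw [pow_zero, mul_one] at h2
  have h3 := abs_sub_abs_le_abs_sub (z 0 : ℝ) (x 0 * Polynomial.aeval ξ Q)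
  rw [abs_mul] at h3
  have h4 : e ≤ 1 / 2 := by
    refine le_trans ?_ hsmall
    rw [mul_assoc]
    exact le_mul_of_one_le_left he0 (by linarith)
  linarith

/-- A nonzero polynomial cannot annihilate all the points of an approximation sequence from some
index on. -/
theorem IsApproximationSequence.exists_annihilates_not_succ {n d : ℕ} {ξ w η : ℝ}
    {x : ℕ → ℕ → ℤ} {L : ℕ → ℝ} (h : IsApproximationSequence n ξ w η x L)
    (hξ : Transcendental ℚ ξ) (hd : d ≤ n) {Q : Polynomial ℤ} (hQ0 : Q ≠ 0)
    (hQ : Q.natDegree ≤ d) {i : ℕ} (hi : Annihilates n d (x i) Q) :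
    ∃ j, i ≤ j ∧ Annihilates n d (x j) Q ∧ ¬ Annihilates n d (x (j + 1)) Q := by
  by_contra hcon
  push Not at hcon
  have hall : ∀ j, i ≤ j → Annihilates n d (x j) Q := fun j hj =>
    Nat.le_induction hi (fun j hj => hcon j hj) j hj
  have h1 : Tendsto (fun j => (n + 1) * Q.supNorm * L j) atTop (nhds 0) := by
    simpa using h.tendsto.const_mul ((n + 1) * Q.supNorm)
  obtain ⟨j, hj, hij⟩ := ((h1.eventually_lt_const
    (abs_pos.2 (aeval_ne_zero_of_transcendental hξ hQ0))).and (eventually_ge_atTop i)).exists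
  have h2 := (hall j hij).abs_aeval_le (h.close j) hQ hd
  have h3 := le_mul_of_one_le_left (abs_nonneg (Polynomial.aeval ξ Q)) (h.one_le j)
  linarith

set_option maxHeartbeats 1000000 in
/-- There is no approximation sequence of exponent `m + 1 + δ` when points near the line through
`(1, ξ, …, ξ ^ k)` have height `≫ L ^ (-δ)`. A form `Q` of degree `n - m` that is the shortest one to
annihilate `x i` is still short relative to the last point `x j` of the run of points that it
annihilates; the first point `x (j + 1)` after the run has a nonzero image under `Q`, whose height is
too small for the lower bound. -/
theorem IsApproximationSequence.false_of_lower_bound {n m t k : ℕ} {ξ δ η : ℝ}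
    {x : ℕ → ℕ → ℤ} {L : ℕ → ℝ} (h : IsApproximationSequence n ξ (m + 1 + δ) η x L)
    (hξ : Transcendental ℚ ξ) (hη : 0 < η) (hn : n = 2 * m + 1 + t) (hk : k ≤ m)
    (hδ0 : 0 ≤ δ) (hδt : δ ≤ t) {c : ℝ} (hc : 0 < c)
    (hlow : ∀ (z : ℕ → ℤ) (L : ℝ), z 0 ≠ 0 → 0 < L → L ≤ 1 → IsClose k ξ z L →
      c * L ^ (-δ) ≤ |(z 0 : ℝ)|) : False := by
  have hξ0 : ξ ≠ 0 := by
    rintro rfl; exact hξ isAlgebraic_zero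
  obtain ⟨C₀, hC₀1, hC₀⟩ := exists_short_annihilator n ξ hξ0
  obtain ⟨C, hC1, hC⟩ := exists_short_common_annihilator n ξ hξ0
  have hnR : (n : ℝ) = 2 * m + 1 + t := by exact_mod_cast hn
  have hn0 : (0 : ℝ) ≤ n := Nat.cast_nonneg n
  obtain ⟨i₁, hi₁⟩ := eventually_atTop.1
    (h.eventually_not_annihilates hξ hη (m := m) (by omega) (by rw [hnR]; linarith) m le_rfl)
  set A : ℝ := ((1 + |ξ|) ^ n + 1) * (n + 1) with hA
  have hA1 : 1 ≤ A := by
    have h1 : (1 : ℝ) ≤ (1 + |ξ|) ^ n := one_le_pow₀ (by have := abs_nonneg ξ; linarith)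
    rw [hA]; nlinarith
  set K : ℝ := 4 * A ^ δ * (n + 1) * C with hK
  obtain ⟨i, ⟨hiA, hiK⟩, hii⟩ :=
    (((h.tendsto_mul_rpow hη (A ^ (t + 1) * C₀ * 2)).eventually_lt_const
      (show (0 : ℝ) < (1 / 2) ^ (t + 1) by positivity)).and
      ((h.tendsto_mul_rpow hη K).eventually_lt_const hc)).and (eventually_ge_atTop i₁) |>.exists
  obtain ⟨Q₀, hQ₀0, hQ₀d, hQ₀x, hQ₀H⟩ :=
    hC₀ m t hn (x i) (L i) (h.close i) (h.le_one i) (h.ne_zero i) (hi₁ i hii)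
  obtain ⟨Q, ⟨hQ0, hQd, hQx⟩, hQmin⟩ := exists_minimal_supNorm
    (fun Q => Q ≠ 0 ∧ Q.natDegree ≤ n - m ∧ Annihilates n (n - m) (x i) Q)
    ⟨Q₀, hQ₀0, hQ₀d, hQ₀x⟩
  set H := Q.supNorm with hH
  have hH1 : 1 ≤ H := one_le_supNorm hQ0
  have hH0 : 0 < H := by linarith
  have hLi0 := h.pos i
  have hLi1 := h.le_one i
  -- the least height of an annihilator of `x i` is `o(1 / L i)`
  have hAHL : A * (H * L i) ≤ 1 / 2 := by
    refine le_of_pow_le_pow_left₀ (Nat.succ_ne_zero t) (by norm_num) (le_trans ?_ hiA.le)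
    have h1 : H ^ (t + 1) ≤ C₀ * (|(x i 0 : ℝ)| * L i ^ m) :=
      (pow_le_pow_left₀ hH0.le (hQmin _ ⟨hQ₀0, hQ₀d, hQ₀x⟩) _).trans hQ₀H
    have h2 : L i ^ m * L i ^ (t + 1) ≤ L i ^ (m + 1 + δ : ℝ) := by
      rw [← pow_add, ← Real.rpow_natCast]
      refine Real.rpow_le_rpow_of_exponent_ge hLi0 hLi1 ?_
      push_cast; linarith
    have h3 : |(x i 0 : ℝ)| * L i ^ (m + 1 + δ : ℝ) ≤ 2 * L i ^ η :=
      (mul_le_mul_of_nonneg_right (h.mono i) (by positivity)).trans (h.gap i)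
    calc (A * (H * L i)) ^ (t + 1) = A ^ (t + 1) * (H ^ (t + 1) * L i ^ (t + 1)) := by
          rw [mul_pow A, mul_pow H]
      _ ≤ A ^ (t + 1) * (C₀ * (|(x i 0 : ℝ)| * L i ^ m) * L i ^ (t + 1)) := by gcongr
      _ = A ^ (t + 1) * C₀ * (|(x i 0 : ℝ)| * (L i ^ m * L i ^ (t + 1))) := by ring
      _ ≤ A ^ (t + 1) * C₀ * (|(x i 0 : ℝ)| * L i ^ (m + 1 + δ : ℝ)) := by gcongr
      _ ≤ A ^ (t + 1) * C₀ * (2 * L i ^ η) := by gcongr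
      _ = _ := by ring
  have hHL1 : H * L i ≤ 1 := by
    have := le_mul_of_one_le_left (by positivity : 0 ≤ H * L i) hA1
    linarith
  obtain ⟨j, hij, hjx, hjx'⟩ :=
    h.exists_annihilates_not_succ hξ (Nat.sub_le n m) hQ0 hQd hQx
  have hLj0 := h.pos j
  have hLj'0 := h.pos (j + 1)
  have hLji : L j ≤ L i := h.anti hij
  have hLj'j : L (j + 1) ≤ L j := h.anti (Nat.le_succ j)
  have hXj : 1 ≤ |(x j 0 : ℝ)| := h.one_le j
  have hXij : |(x i 0 : ℝ)| ≤ |(x j 0 : ℝ)| :=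
    monotone_nat_of_le_succ (f := fun i => |(x i 0 : ℝ)|) h.mono hij
  -- by minimality of its height, `Q` is short for both `x i` and `x j`
  have hHδ : H ^ (1 + δ) ≤ C * (|(x j 0 : ℝ)| * L j ^ m) := by
    obtain ⟨s, hst, Q', hQ'0, hQ'd, hQ'x, hQ'H⟩ := hC m t hn (x j) (x i) (L j) (L i)
      |(x j 0 : ℝ)| (h.close j) (h.close i) hLj0 hLji hLi1 hXj le_rfl hXij
      (hi₁ j (hii.trans hij)) Q hQ0 hQd hjx hQx
    have h1 : H ^ (t + 1 - s) ≤ C * (|(x j 0 : ℝ)| * (L j ^ m * L i ^ s)) :=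
      (pow_le_pow_left₀ hH0.le (hQmin _ ⟨hQ'0, hQ'd, hQ'x⟩) _).trans hQ'H
    have h2 : H ^ (1 + δ) ≤ H ^ (t + 1 - s) * H ^ s := by
      rw [← pow_add, Nat.sub_add_cancel (by omega), ← Real.rpow_natCast]
      refine Real.rpow_le_rpow_of_exponent_le hH1 ?_
      push_cast; linarith
    have h3 : (H * L i) ^ s ≤ 1 := pow_le_one₀ (by positivity) hHL1
    calc H ^ (1 + δ) ≤ H ^ (t + 1 - s) * H ^ s := h2
      _ ≤ C * (|(x j 0 : ℝ)| * (L j ^ m * L i ^ s)) * H ^ s := by gcongr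
      _ = C * (|(x j 0 : ℝ)| * L j ^ m) * (H * L i) ^ s := by rw [mul_pow]; ring
      _ ≤ C * (|(x j 0 : ℝ)| * L j ^ m) * 1 := by gcongr
      _ = _ := mul_one _
  set ℓ : ℝ := A * (H * L (j + 1)) with hℓ
  have hℓ0 : 0 < ℓ := by positivity
  have hℓj : ℓ ≤ A * (H * L j) := by rw [hℓ]; gcongr
  have hℓ2 : ℓ ≤ 1 / 2 := by
    refine le_trans ?_ hAHL
    rw [hℓ]
    have := hLj'j.trans hLji
    gcongr
  obtain ⟨hz0, hz, hzQ⟩ := isClose_momentPairing (h.close (j + 1)) (by omega) hQd hjx' hℓ2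
  have h1 := hlow (fun v => momentPairing (shift v (x (j + 1))) Q) ℓ hz0 hℓ0
    (by linarith) fun v hv => hz v (hv.trans hk)
  have h2 := hjx.abs_aeval_le (h.close j) hQd (Nat.sub_le n m)
  set q := |Polynomial.aeval ξ Q| with hq
  have hq0 : 0 ≤ q := abs_nonneg _
  have h3 : c ≤ ℓ ^ δ * (2 * (|(x (j + 1) 0 : ℝ)| * q)) := by
    calc c = ℓ ^ δ * (c * ℓ ^ (-δ)) := by
          rw [mul_left_comm, ← Real.rpow_add hℓ0]; simp
      _ ≤ _ := by
          refine mul_le_mul_of_nonneg_left (h1.trans hzQ) (by positivity)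
  have h4 : ℓ ^ δ ≤ A ^ δ * (H ^ δ * L j ^ δ) := by
    rw [← Real.mul_rpow hH0.le hLj0.le, ← Real.mul_rpow (by linarith) (by positivity)]
    exact Real.rpow_le_rpow hℓ0.le hℓj hδ0
  have h5 : |(x j 0 : ℝ)| * c ≤ |(x j 0 : ℝ)| * (K * L j ^ η) := by
    have hX' := abs_nonneg (x (j + 1) 0 : ℝ)
    calc |(x j 0 : ℝ)| * c
        ≤ |(x j 0 : ℝ)| * (ℓ ^ δ * (2 * (|(x (j + 1) 0 : ℝ)| * q))) := by gcongr
      _ = 2 * |(x (j + 1) 0 : ℝ)| * ℓ ^ δ * (|(x j 0 : ℝ)| * q) := by ring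
      _ ≤ 2 * |(x (j + 1) 0 : ℝ)| * (A ^ δ * (H ^ δ * L j ^ δ)) * ((n + 1) * H * L j) := by
          gcongr
      _ = 2 * A ^ δ * (n + 1) * |(x (j + 1) 0 : ℝ)| * H ^ (1 + δ) * L j ^ (1 + δ) := by
          rw [Real.rpow_add hH0, Real.rpow_add hLj0, Real.rpow_one, Real.rpow_one]; ring
      _ ≤ 2 * A ^ δ * (n + 1) * |(x (j + 1) 0 : ℝ)| * (C * (|(x j 0 : ℝ)| * L j ^ m)) *
            L j ^ (1 + δ) := by gcongr
      _ = 2 * A ^ δ * (n + 1) * C * |(x j 0 : ℝ)| *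
            (|(x (j + 1) 0 : ℝ)| * L j ^ (m + 1 + δ : ℝ)) := by
          rw [add_assoc (m : ℝ), Real.rpow_add hLj0 (m : ℝ), Real.rpow_natCast]; ring
      _ ≤ 2 * A ^ δ * (n + 1) * C * |(x j 0 : ℝ)| * (2 * L j ^ η) :=
          mul_le_mul_of_nonneg_left (h.gap j) (by positivity)
      _ = _ := by rw [hK]; ring
  have h6 : c ≤ K * L j ^ η := le_of_mul_le_mul_left h5 (by linarith)
  have h7 : K * L j ^ η ≤ K * L i ^ η := by
    have : 0 ≤ K := by positivity
    gcongr
  linarith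

/-! ### Bounds for the uniform exponent -/

/-- Points of least first coordinate, among those within `2 ^ (-lam * i)` of the line through
`(1, ξ, …, ξ ^ n)`, form an approximation sequence. -/
theorem exists_isApproximationSequence {n : ℕ} {ξ lam w : ℝ} (hlam : 0 < lam) (hw : 1 < lam * w)
    (h : ∀ᶠ Q : ℝ in atTop, SimultaneousSolvable n ξ lam Q) :
    ∃ η > 0, ∃ x L, IsApproximationSequence n ξ w η x L := by
  have hpow : Tendsto (fun i : ℕ => (2 : ℝ) ^ i) atTop atTop :=
    tendsto_pow_atTop_atTop_of_one_lt one_lt_two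
  obtain ⟨i₀, hi₀⟩ := eventually_atTop.1 (hpow.eventually h)
  set T : ℕ → ℝ := fun i => 2 ^ (i + i₀) with hT
  have hT0 : ∀ i, 0 < T i := fun i => by positivity
  have hT1 : ∀ i, 1 ≤ T i := fun i => one_le_pow₀ one_le_two
  set L : ℕ → ℝ := fun i => T i ^ (-lam) with hL
  have hL0 : ∀ i, 0 < L i := fun i => Real.rpow_pos_of_pos (hT0 i) _
  have hLanti : Antitone L := by
    refine antitone_nat_of_succ_le fun i => ?_
    refine Real.rpow_le_rpow_of_nonpos (hT0 i) ?_ (by linarith)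
    exact pow_le_pow_right₀ one_le_two (by omega)
  have hsol : ∀ i, ∃ z : ℕ → ℤ, z 0 ≠ 0 ∧ IsClose n ξ z (L i) ∧ |(z 0 : ℝ)| ≤ T i := by
    intro i
    obtain ⟨y, hy1, hyQ, hy⟩ := hi₀ (i + i₀) (by omega)
    obtain ⟨z, hz⟩ : ∃ z : ℕ → ℤ, ∀ l (hl : l < n + 1), z l = y ⟨l, hl⟩ :=
      ⟨fun l => if hl : l < n + 1 then y ⟨l, hl⟩ else 0, fun l hl => dif_pos hl⟩
    have h0 : z 0 = y 0 := hz 0 (Nat.succ_pos n)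
    refine ⟨z, ?_, ?_, ?_⟩
    · rw [h0]; rintro h1; rw [h1] at hy1; norm_num at hy1
    · intro l hl
      rw [h0, hz l (Nat.lt_succ_of_le hl)]
      rcases l with _ | l
      · simpa using (hL0 i).le
      · exact (hy ⟨l, hl⟩).le
    · rw [h0, ← Int.cast_abs]; exact hyQ
  have hmin : ∀ i, ∃ z : ℕ → ℤ, (z 0 ≠ 0 ∧ IsClose n ξ z (L i)) ∧
      ∀ z' : ℕ → ℤ, z' 0 ≠ 0 → IsClose n ξ z' (L i) → (z 0).natAbs ≤ (z' 0).natAbs := by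
    classical
    intro i
    have hex : ∃ a : ℕ, ∃ z : ℕ → ℤ, (z 0 ≠ 0 ∧ IsClose n ξ z (L i)) ∧ (z 0).natAbs = a := by
      obtain ⟨z, hz0, hz, -⟩ := hsol i
      exact ⟨_, z, ⟨hz0, hz⟩, rfl⟩
    obtain ⟨z, hz, hza⟩ := Nat.find_spec hex
    refine ⟨z, hz, fun z' h0 h1 => ?_⟩
    rw [hza]
    exact Nat.find_min' hex ⟨z', ⟨h0, h1⟩, rfl⟩
  choose x hx hxmin using hmin
  have hcast : ∀ a b : ℤ, a.natAbs ≤ b.natAbs → |(a : ℝ)| ≤ |(b : ℝ)| := by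
    intro a b hab
    rw [← Int.cast_abs, ← Int.cast_abs, Int.cast_le, Int.abs_eq_natAbs, Int.abs_eq_natAbs]
    exact_mod_cast hab
  have hxT : ∀ i, |(x i 0 : ℝ)| ≤ T i := by
    intro i
    obtain ⟨z, hz0, hz, hzT⟩ := hsol i
    exact (hcast _ _ (hxmin i z hz0 hz)).trans hzT
  refine ⟨w - 1 / lam, ?_, x, L, fun i => (hx i).1, fun i => (hx i).2, fun i => ?_, hL0,
    fun i => ?_, hLanti, ?_, fun i => ?_⟩
  · rw [gt_iff_lt, sub_pos, div_lt_iff₀ hlam]; linarith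
  · exact hcast _ _ (hxmin i _ (hx (i + 1)).1 ((hx (i + 1)).2.mono (hLanti (Nat.le_succ i))))
  · exact Real.rpow_le_one_of_one_le_of_nonpos (hT1 i) (by linarith)
  · exact (tendsto_rpow_neg_atTop hlam).comp ((tendsto_add_atTop_iff_nat i₀).2 hpow)
  · have h1 : T (i + 1) = 2 * T i := by simp only [hT]; ring
    have h2 : T i * L i ^ w = L i ^ (w - 1 / lam) := by
      simp only [hL]
      rw [← Real.rpow_mul (hT0 i).le, ← Real.rpow_mul (hT0 i).le, ← Real.rpow_one_add' (hT0 i).le]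
      · congr 1; field_simp; ring
      · nlinarith
    calc |(x (i + 1) 0 : ℝ)| * L i ^ w ≤ T (i + 1) * L i ^ w :=
          mul_le_mul_of_nonneg_right (hxT (i + 1)) (Real.rpow_nonneg (hL0 i).le _)
      _ = 2 * (T i * L i ^ w) := by rw [h1]; ring
      _ = _ := by rw [h2]

/-- When `deltaExponent k ξ` is a positive real number, the dual exponent is finite: for the two
infinite values the quotient defining `deltaExponent` is `0`. -/
theorem dualExponent_eq_of_deltaExponent_eq {k : ℕ} {ξ δ : ℝ}
    (h : deltaExponent k ξ = (δ : EReal)) (hδ : 0 < δ) :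
    dualExponent k ξ = ((k - 1 + k / δ : ℝ) : EReal) := by
  unfold deltaExponent at h
  have hk : (k : EReal) = ((k : ℝ) : EReal) := rfl
  induction hω : dualExponent k ξ with
  | bot =>
    rw [hω, hk, EReal.bot_add, sub_eq_add_neg, EReal.bot_add, EReal.div_bot] at h
    exact absurd (EReal.coe_eq_zero.1 h.symm) hδ.ne'
  | top =>
    have h1 : (⊤ : EReal) + 1 - (k : EReal) = ⊤ := by
      rw [hk, ← EReal.coe_one, EReal.top_add_coe, EReal.top_sub_coe]
    rw [hω, h1, EReal.div_top] at h
    exact absurd (EReal.coe_eq_zero.1 h.symm) hδ.ne'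
  | coe ω =>
    rw [hω, hk, ← EReal.coe_one, ← EReal.coe_add, ← EReal.coe_sub, ← EReal.coe_div,
      EReal.coe_eq_coe_iff] at h
    rw [EReal.coe_eq_coe_iff]
    have h1 : ω + 1 - k ≠ 0 := by
      intro h0; rw [h0, div_zero] at h; exact hδ.ne h
    rw [div_eq_iff h1] at h
    have h2 : (k : ℝ) / δ = ω + 1 - k := by rw [div_eq_iff hδ.ne']; linarith
    linarith

/-- Integer points near the line through `(1, ξ, …, ξ ^ k)` have height `≫ L ^ (-δ')` for each
`δ' < deltaExponent k ξ`. -/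
theorem exists_lower_bound_of_lt_deltaExponent {k : ℕ} (hk : 1 ≤ k) {ξ : ℝ}
    (hξ : Transcendental ℚ ξ) {δ δ' : ℝ} (h : deltaExponent k ξ = (δ : EReal)) (h0 : 0 ≤ δ')
    (hlt : δ' < δ) :
    ∃ c : ℝ, 0 < c ∧ ∀ (z : ℕ → ℤ) (L : ℝ), z 0 ≠ 0 → 0 < L → L ≤ 1 → IsClose k ξ z L →
      c * L ^ (-δ') ≤ |(z 0 : ℝ)| := by
  rcases h0.eq_or_lt with rfl | h0
  · refine ⟨1, one_pos, fun z L hz _ _ _ => ?_⟩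
    rw [neg_zero, Real.rpow_zero, one_mul, ← Int.cast_abs]
    exact_mod_cast Int.one_le_abs hz
  · have hk0 : (0 : ℝ) < k := by exact_mod_cast hk
    set w : ℝ := k - 1 + k / δ' with hw
    have hpos : 0 < (k : ℝ) / δ' := div_pos hk0 h0
    have hnot : ∀ᶠ Q : ℝ in atTop, ¬ DualSolvable k ξ w Q := by
      rw [← not_frequently]
      intro hfreq
      have h1 : (w : EReal) ≤ dualExponent k ξ :=
        le_iSup₂ (f := fun (w : ℝ) (_ : ∃ᶠ Q : ℝ in atTop, DualSolvable k ξ w Q) => (w : EReal))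
          w hfreq
      rw [dualExponent_eq_of_deltaExponent_eq h (h0.trans hlt), EReal.coe_le_coe_iff] at h1
      have h2 := div_lt_div_of_pos_left hk0 h0 hlt
      linarith
    have h3 := exists_lower_bound_of_not_dualSolvable hk hξ (by rw [hw]; linarith) hnot
    have h4 : (k : ℝ) / (w + 1 - k) = δ' := by
      rw [show w + 1 - k = k / δ' by rw [hw]; ring, div_div_cancel₀ hk0.ne']
    rwa [h4] at h3

/-- The bound for the uniform exponent that each choice of an intermediate degree `m` provides. -/
theorem uniformSimultaneousExponent_le {n m t k : ℕ} (hk : 1 ≤ k) (hkm : k ≤ m)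
    (hn : n = 2 * m + 1 + t) {ξ : ℝ} (hξ : Transcendental ℚ ξ) {δ : ℝ} (hδ0 : 0 < δ)
    (hδ : deltaExponent k ξ = (δ : EReal)) :
    uniformSimultaneousExponent n ξ ≤ ((1 / (m + 1 + min δ t) : ℝ) : EReal) := by
  by_contra hcon
  rw [not_le, uniformSimultaneousExponent] at hcon
  obtain ⟨lam, hlam⟩ := lt_iSup_iff.1 hcon
  obtain ⟨hsolv, hlam⟩ := lt_iSup_iff.1 hlam
  rw [EReal.coe_lt_coe_iff] at hlam
  have hm0 : (0 : ℝ) ≤ m := Nat.cast_nonneg m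
  have ht0 : (0 : ℝ) ≤ t := Nat.cast_nonneg t
  have hmin0 : 0 ≤ min δ (t : ℝ) := le_min hδ0.le ht0
  have hlam0 : 0 < lam := lt_trans (by positivity) hlam
  rw [div_lt_iff₀ (by linarith)] at hlam
  -- an exponent below `δ`, so that the transference bound applies, still large enough
  obtain ⟨δ', hδ'0, hδ't, hδ'δ, hδ'⟩ :
      ∃ δ' : ℝ, 0 ≤ δ' ∧ δ' ≤ t ∧ δ' < δ ∧ 1 < lam * (m + 1 + δ') := by
    rcases lt_or_ge (t : ℝ) δ with h | h
    · exact ⟨t, ht0, le_rfl, h, by rwa [min_eq_right h.le] at hlam⟩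
    · rw [min_eq_left h] at hlam
      have h1 : 1 / lam - (m + 1) < δ := by
        rw [sub_lt_iff_lt_add, div_lt_iff₀ hlam0]; linarith
      obtain ⟨δ', h2, h3⟩ := exists_between (max_lt hδ0 h1)
      refine ⟨δ', (le_max_left _ _).trans h2.le, by linarith, h3, ?_⟩
      have h4 := (le_max_right _ _).trans_lt h2
      rw [sub_lt_iff_lt_add, div_lt_iff₀ hlam0] at h4
      linarith
  obtain ⟨η, hη, x, L, hx⟩ := exists_isApproximationSequence hlam0 hδ' hsolv
  obtain ⟨c, hc, hlow⟩ := exists_lower_bound_of_lt_deltaExponent hk hξ hδ hδ'0 hδ'δ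
  exact hx.false_of_lower_bound hξ hη hn hkm hδ'0 hδ't hc hlow

theorem deltaExponent_eq_of_dualExponent_eq {k : ℕ} {ξ : ℝ} (h : dualExponent k ξ = (k : EReal)) :
    deltaExponent k ξ = ((k : ℝ) : EReal) := by
  have hk : (k : EReal) = ((k : ℝ) : EReal) := rfl
  rw [deltaExponent, h, hk, ← EReal.coe_one, ← EReal.coe_add, ← EReal.coe_sub, ← EReal.coe_div,
    EReal.coe_eq_coe_iff, add_sub_cancel_left, div_one]

theorem one_div_le_three_div_add {c n D : ℝ} (hc : 0 ≤ c) (hn : 0 < n) (hD : 1 ≤ D)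
    (hDn : 2 * n - c ≤ 3 * D) : 1 / D ≤ 3 / (2 * n) + (3 * c + c ^ 2) / n ^ 2 := by
  have h1 : 3 / (2 * n) + (3 * c + c ^ 2) / n ^ 2 = (3 / 2 * n + (3 * c + c ^ 2)) / n ^ 2 := by
    field_simp
  rw [h1, div_le_div_iff₀ (by linarith) (by positivity), one_mul]
  rcases le_or_gt n c with h | h
  · nlinarith
  · nlinarith [mul_nonneg hc (sub_nonneg.2 h.le), mul_nonneg (sub_nonneg.2 hDn) hn.le,
      mul_nonneg (sub_nonneg.2 hDn) hc, mul_nonneg (by linarith : (0 : ℝ) ≤ D) (sq_nonneg c)]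

theorem theorem2 :
    (∀ (ξ : ℝ), Transcendental ℚ ξ → ∀ (k : ℕ), 1 ≤ k →
      ∀ (δ : ℝ), deltaExponent k ξ = (δ : EReal) → 1 ≤ δ →
        ∀ (n : ℕ),
          (2 * k + 1 ≤ n → (n : ℝ) < 2 * (k : ℝ) + 1 + δ →
            uniformSimultaneousExponent n ξ ≤ ((1 / ((n : ℝ) - (k : ℝ)) : ℝ) : EReal)) ∧
          (2 * (k : ℝ) + 1 + δ ≤ (n : ℝ) →
            uniformSimultaneousExponent n ξ ≤
              ((min (1 / ((n : ℝ) - (⌈((n : ℝ) - δ - 1) / 2⌉ : ℝ)))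
                    (1 / ((⌊((n : ℝ) - δ - 1) / 2⌋ : ℝ) + 1 + δ)) : ℝ) : EReal))) ∧
    (∀ (c : ℕ), ∃ (C : ℝ), ∀ (ξ : ℝ), Transcendental ℚ ξ → ∀ (k n : ℕ), 1 ≤ k →
      2 * k + 1 ≤ n → |(n : ℤ) - 3 * (k : ℤ)| ≤ (c : ℤ) →
        dualExponent k ξ = (k : EReal) →
          uniformSimultaneousExponent n ξ ≤
            ((3 / (2 * (n : ℝ)) + C / (n : ℝ) ^ 2 : ℝ) : EReal)) := by
  refine ⟨fun ξ hξ k hk δ hδ hδ1 n => ⟨fun hkn hnδ => ?_, fun hnδ => ?_⟩, fun c => ?_⟩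
  · obtain ⟨t, rfl⟩ := Nat.exists_eq_add_of_le hkn
    have h1 := uniformSimultaneousExponent_le hk le_rfl rfl hξ (by linarith) hδ (t := t)
    push_cast at hnδ
    rw [min_eq_right (by linarith)] at h1
    convert h1 using 3
    push_cast; ring
  · set s : ℝ := ((n : ℝ) - δ - 1) / 2 with hs
    have hks : (k : ℝ) ≤ s := by rw [hs]; linarith
    rcases min_choice (1 / ((n : ℝ) - ⌈s⌉)) (1 / ((⌊s⌋ : ℝ) + 1 + δ)) with h | h <;> rw [h]
    · have h0 : (k : ℤ) ≤ ⌈s⌉ := by exact_mod_cast hks.trans (Int.le_ceil s)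
      obtain ⟨m, hm⟩ := Int.eq_ofNat_of_zero_le ((Int.natCast_nonneg k).trans h0)
      rw [hm, Int.cast_natCast]
      have h1 := Int.le_ceil s
      have h2 := Int.ceil_lt_add_one s
      rw [hm, Int.cast_natCast] at h1 h2
      have h3 : 2 * m + 1 ≤ n := by
        have : (2 * m : ℝ) < n := by linarith
        exact_mod_cast this
      obtain ⟨t, rfl⟩ := Nat.exists_eq_add_of_le h3
      have h4 := uniformSimultaneousExponent_le hk (by omega) rfl hξ (by linarith) hδ
        (m := m) (t := t)
      push_cast at hs
      rw [min_eq_right (by linarith)] at h4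
      convert h4 using 3
      push_cast; ring
    · have h0 : (k : ℤ) ≤ ⌊s⌋ := by rw [Int.le_floor]; exact_mod_cast hks
      obtain ⟨m, hm⟩ := Int.eq_ofNat_of_zero_le ((Int.natCast_nonneg k).trans h0)
      rw [hm, Int.cast_natCast]
      have h1 := Int.floor_le s
      rw [hm, Int.cast_natCast] at h1
      have h3 : 2 * m + 1 ≤ n := by
        have : (2 * m + 1 : ℝ) ≤ n := by linarith
        exact_mod_cast this
      obtain ⟨t, rfl⟩ := Nat.exists_eq_add_of_le h3
      have h4 := uniformSimultaneousExponent_le hk (by omega) rfl hξ (by linarith) hδ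
        (m := m) (t := t)
      push_cast at hs
      rwa [min_eq_left (by linarith)] at h4
  · refine ⟨3 * c + c ^ 2, fun ξ hξ k n hk hkn hnc hω => ?_⟩
    have hδ := deltaExponent_eq_of_dualExponent_eq hω
    have hk0 : (0 : ℝ) < k := by exact_mod_cast hk
    obtain ⟨hc1, hc2⟩ := abs_le.1 hnc
    -- the intermediate degree is `k` or `(n - k - 1) / 2`, whichever is larger
    obtain ⟨m, t, hkm, hn, hmt⟩ : ∃ m t : ℕ, k ≤ m ∧ n = 2 * m + 1 + t ∧
        2 * n ≤ 3 * (m + 1 + min k t) + c := by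
      rcases le_or_gt (3 * k + 1) n with h | h
      · exact ⟨(n - k - 1) / 2, n - (2 * ((n - k - 1) / 2) + 1), by omega, by omega, by omega⟩
      · exact ⟨k, n - (2 * k + 1), le_rfl, by omega, by omega⟩
    refine (uniformSimultaneousExponent_le hk hkm hn hξ hk0 hδ).trans ?_
    rw [EReal.coe_le_coe_iff, ← Nat.cast_min]
    refine one_div_le_three_div_add (Nat.cast_nonneg c) (by exact_mod_cast (by omega : 0 < n)) ?_ ?_
    · have : (1 : ℕ) ≤ m + 1 + min k t := by omega
      exact_mod_cast this
    · have : (2 * n : ℝ) ≤ 3 * (m + 1 + (min k t : ℕ)) + c := by exact_mod_cast hmt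
      linarith
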